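/- Setting. Let $\mathcal R\subset\mathbb R^d$ be the lattice generated by a basis $Y_1,\dots,Y_d$ and let $\mathcal V$ be a unit cell (a fundamental domain of $\mathcal R$ up to null sets); $\langle\cdot\rangle$ denotes the average over $\mathcal V$ and $s:e=\sum_{i,j}s_{ij}e_{ij}$. Let $L_0$ be a uniform, positive definite fourth-order tensor with major and minor symmetries, and let $L(x)$ be a measurable fourth-order tensor field on $\mathcal V$ with major and minor symmetries, bounded and uniformly positive definite: for some $0<\alpha\le\beta$, $\alpha\,a:a\le L(x)a:a\le\beta\,a:a$ for a.e. $x\in\mathcal V$ and all symmetric $a$. Let $\bar\varepsilon$ be a given constant symmetric tensor. Let $H_e$ and $H_s$ be the space of symmetric $\mathcal R$-periodic $L^2_{\rm loc}$ tensor fields (identified with their restrictions to $\mathcal V$), with the scalar products $(\eta,\tilde\eta)_e=\langle L_0\eta:\tilde\eta\rangle$ and $(\tau,\tilde\tau)_s=\langle\tau:L_0^{-1}\tilde\tau\rangle$ respectively. Let $E_0\subset H_e$ be the set of fields $\tfrac12(\nabla w+\nabla w^{\top})$ with $w\in H^1_{\rm per}(\mathcal V)^d$, and let $E$ be the sum of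 $E_0$ and the uniform fields. Let $S_0\subset H_s$ be the set of mean-free fields $s$ with $\operatorname{div}s=0$ in $\mathcal V$ and $s\cdot n$ anti-periodic on $\partial\mathcal V$ (that is, the periodic extension of $s$ is divergence-free in the sense of distributions on $\mathbb R^d$), and let $S$ be the sum of $S_0$ and the uniform fields. Let $P_{E_0}$ be the orthogonal projector of $H_e$ onto $E_0$ and $P_{S^\perp}$ the orthogonal projector of $H_s$ onto $S^\perp$. For $\tau\in H_s$ let $\Gamma_0\tau$ be the solution $e^*$ of the Eshelby problem: $e^*\in E_0$ and $L_0e^*-\tau\in S$. Define on $H_s\times H_e$ $$P(\tau,\eta)=\tfrac12\|(I-P_{E_0})\eta-\bar\varepsilon\|_e^2+\big\langle\tfrac12L\eta:\eta+\tfrac12\tau:L^{-1}\tau-\tau:\eta\big\rangle+\tfrac12\|P_{S^\perp}\tau\|_s^2 .$$ The partial gradient $\nabla_\tau P(\tau,\eta)\in H_s$ (resp. $\nabla_\eta P(\tau,\eta)\in H_e$) is the element whose scalar product $(\cdot,\cdot)_s$ (resp. $(\cdot,\cdot)_e$) with every direction is the directional derivative of $P$ in that direction. Statement. The projectors $P_{E_0}$,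 $P_{S^\perp}$ and the operator $\Gamma_0$ are well defined (the fields defining them exist and are unique), and the following hold. 1. If $(\sigma,\varepsilon)\in H_s\times H_e$ satisfies $\nabla_\tau P(\sigma,\varepsilon)=0$ and $\nabla_\eta P(\sigma,\varepsilon)=0$, then $$\sigma(x)=L(x)\varepsilon(x)\ \text{ for a.e. } x\in\mathcal V,\qquad (I-\Gamma_0L_0)\varepsilon=\bar\varepsilon,\qquad \Gamma_0\sigma=0 .$$ 2. For every $(\sigma,\varepsilon)\in H_s\times H_e$, these three equations are equivalent to the periodic elasticity problem: $\varepsilon\in E$ with $\langle\varepsilon\rangle=\bar\varepsilon$; $\sigma(x)=L(x)\varepsilon(x)$ for a.e. $x\in\mathcal V$; and $\sigma\in S$. 3. $P$ has exactly one minimizer on $H_s\times H_e$, and a pair $(\sigma,\varepsilon)$ minimizes $P$ if and only if it solves this elasticity problem. -/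

import Mathlib

open MeasureTheory Filter Topology
open scoped ContDiff ENNReal

namespace PeriodicElasticity

noncomputable section

/-- The physical space `ℝ^d`. -/
abbrev Space (d : ℕ) : Type := EuclideanSpace ℝ (Fin d)

/-- Symmetric second-order tensors. The inner product inherited from the Euclidean space is the
doubly contracted product `s : e = ∑ i j, s i j * e i j`. -/
def symTensors (d : ℕ) : Submodule ℝ (EuclideanSpace ℝ (Fin d × Fin d)) where
  carrier := {A | ∀ i j, A (i, j) = A (j, i)}
  add_mem' := by
    intro A B hA hB i j
    simp only [PiLp.add_apply, hA i j, hB i j]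
  zero_mem' := by
    intro i j
    simp
  smul_mem' := by
    intro c A hA i j
    simp only [PiLp.smul_apply, hA i j]

/-- The type of symmetric second-order tensors. -/
abbrev SymTensor (d : ℕ) : Type := symTensors d

/-- The `(i, j)` component of a symmetric tensor. -/
def SymTensor.comp {d : ℕ} (A : SymTensor d) (i j : Fin d) : ℝ :=
  (A : EuclideanSpace ℝ (Fin d × Fin d)) (i, j)

/-- Fourth-order tensors acting on symmetric tensors by `(L e) i j = ∑ k l, L i j k l * e k l`.
The minor symmetries say that `L` is a linear operator on symmetric tensors; the major symmetry
then says that this operator is self-adjoint for the doubly contracted product. -/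
abbrev Tensor4 (d : ℕ) : Type := SymTensor d →L[ℝ] SymTensor d

/-- Major symmetry of a fourth-order tensor. -/
def Tensor4.MajorSymm {d : ℕ} (A : Tensor4 d) : Prop :=
  ∀ a b : SymTensor d, inner ℝ (A a) b = inner ℝ (A b) a

/-- A uniform stiffness tensor: positive definite, with major and minor symmetries. -/
def Tensor4.IsStiffness {d : ℕ} (A : Tensor4 d) : Prop :=
  A.MajorSymm ∧ ∀ a : SymTensor d, a ≠ 0 → 0 < inner ℝ (A a) a

/-- A unit cell: a set `cell` that fills `ℝ^d`, up to null sets and without overlap, by the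
translations of the lattice generated by the `d` vectors `Y i`. -/
structure UnitCell (d : ℕ) where
  /-- the periods -/
  Y : Module.Basis (Fin d) ℝ (Space d)
  /-- the unit cell -/
  cell : Set (Space d)
  /-- the translates of the cell fill the space -/
  tiles : IsAddFundamentalDomain (Submodule.span ℤ (Set.range Y)).toAddSubgroup cell
    (volume : Measure (Space d))

variable {d : ℕ}

/-- Lebesgue measure on the unit cell. -/
abbrev UnitCell.meas (C : UnitCell d) : Measure (Space d) := volume.restrict C.cell

instance UnitCell.instIsFiniteMeasure (C : UnitCell d) : IsFiniteMeasure C.meas := by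
  have : Countable (Submodule.span ℤ (Set.range C.Y)).toAddSubgroup :=
    inferInstanceAs (Countable (Submodule.span ℤ (Set.range C.Y)))
  refine ⟨?_⟩
  rw [Measure.restrict_apply_univ, C.tiles.measure_eq (ZSpan.isAddFundamentalDomain' C.Y volume)]
  exact (ZSpan.fundamentalDomain_isBounded C.Y).measure_lt_top

/-- Square-integrable symmetric tensor fields. A periodic field is determined by its restriction
to the unit cell, so that the space of `L²` periodic tensor fields is realised as `L²(cell)`.
Both strain fields (the space `H_e`) and stress fields (the space `H_s`) are of this type;
the two spaces differ by their scalar products. -/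
abbrev TField (C : UnitCell d) : Type := Lp (SymTensor d) 2 C.meas

/-- `f ∈ L²_per`: `f` is locally square-integrable on `ℝ^d` and periodic. -/
def MemL2Per (C : UnitCell d) (f : Space d → ℝ) : Prop :=
  (∀ K : Set (Space d), IsCompact K → MemLp f 2 (volume.restrict K)) ∧
    ∀ Y ∈ Submodule.span ℤ (Set.range C.Y), ∀ᵐ x : Space d, f (x + Y) = f x

/-- The `j`-th partial derivative of a scalar function. -/
def pderiv (j : Fin d) (φ : Space d → ℝ) (x : Space d) : ℝ :=
  fderiv ℝ φ x (EuclideanSpace.single j 1)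

/-- `g` is the weak `j`-th partial derivative of `f` on `ℝ^d`. -/
def HasWeakPDeriv (j : Fin d) (f g : Space d → ℝ) : Prop :=
  ∀ φ : Space d → ℝ, ContDiff ℝ ∞ φ → HasCompactSupport φ →
    ∫ x, f x * pderiv j φ x = - ∫ x, g x * φ x

/-- `w : ℝ^d → ℝ^d` belongs to `H¹_per`, with weak gradient `(∇w) i j = ∂_j w_i = G i j`. -/
def MemH1PerWithGrad (C : UnitCell d) (w : Fin d → Space d → ℝ)
    (G : Fin d → Fin d → Space d → ℝ) : Prop :=
  (∀ i, MemL2Per C (w i)) ∧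
    ∀ i j, MemL2Per C (G i j) ∧ HasWeakPDeriv j (w i) (G i j)

/-- Uniform fields (`U_e` and `U_s`). -/
def uniformFields (C : UnitCell d) : Set (TField C) :=
  Set.range (Lp.const 2 C.meas)

/-- Compatible strain fields `E_0`: symmetrised gradients of `H¹` periodic displacements. -/
def compatFields (C : UnitCell d) : Set (TField C) :=
  {e | ∃ (w : Fin d → Space d → ℝ) (G : Fin d → Fin d → Space d → ℝ),
    MemH1PerWithGrad C w G ∧
      ∀ᵐ x ∂C.meas, ∀ i j, (e x).comp i j = (1 / 2) * (G i j x + G j i x)}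

/-- Admissible strain fields `E = U_e ⊕ E_0`. -/
def admStrains (C : UnitCell d) : Set (TField C) :=
  {η | ∃ u ∈ uniformFields C, ∃ e ∈ compatFields C, η = u + e}

/-- Self-equilibrated stress fields `S_0`. For a square-integrable field, `div s = 0` in the cell
together with anti-periodicity of the traction `s · n` on its boundary means that the periodic
extension `S` of `s` to `ℝ^d` has zero divergence in the sense of distributions on `ℝ^d`. -/
def selfEqFields (C : UnitCell d) : Set (TField C) :=
  {s | (∃ S : Fin d → Fin d → Space d → ℝ,
      (∀ i j, MemL2Per C (S i j)) ∧
      (∀ᵐ x ∂C.meas, ∀ i j, (s x).comp i j = S i j x) ∧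
      ∀ (i : Fin d) (φ : Space d → ℝ), ContDiff ℝ ∞ φ → HasCompactSupport φ →
        ∑ j, ∫ x, S i j x * pderiv j φ x = 0) ∧
    ⨍ x in C.cell, s x = 0}

/-- Admissible stress fields `S = U_s ⊕ S_0`. -/
def admStresses (C : UnitCell d) : Set (TField C) :=
  {τ | ∃ u ∈ uniformFields C, ∃ s ∈ selfEqFields C, τ = u + s}

/-- Energetic scalar product on strain fields: the average of `L₀ η : η'`. -/
def strainInner (C : UnitCell d) (L₀ : Tensor4 d) (η η' : TField C) : ℝ :=
  ⨍ x in C.cell, inner ℝ (L₀ (η x)) (η' x)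

/-- Energetic scalar product on stress fields: the average of `τ : L₀⁻¹ τ'`. -/
def stressInner (C : UnitCell d) (L₀ : Tensor4 d) (τ τ' : TField C) : ℝ :=
  ⨍ x in C.cell, inner ℝ (τ x) (L₀.inverse (τ' x))

/-- `p` is the orthogonal projection of `η` onto `K` for the scalar product `ip`. -/
def IsOrthProj {H : Type*} [AddCommGroup H] (ip : H → H → ℝ) (K : Set H) (η p : H) : Prop :=
  p ∈ K ∧ ∀ k ∈ K, ip (η - p) k = 0

open Classical in
/-- Orthogonal projection onto `K` for the scalar product `ip` (and `0` where there is none). -/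
def orthProj {H : Type*} [AddCommGroup H] (ip : H → H → ℝ) (K : Set H) (η : H) : H :=
  if h : ∃ p, IsOrthProj ip K η p then h.choose else 0

/-- Orthogonal complement of `K` for the scalar product `ip`. -/
def orthCompl {H : Type*} (ip : H → H → ℝ) (K : Set H) : Set H :=
  {η | ∀ k ∈ K, ip η k = 0}

/-- The space `S^⊥`, the orthogonal complement of `S` in `H_s`. -/
def admStressesOrth (C : UnitCell d) (L₀ : Tensor4 d) : Set (TField C) :=
  orthCompl (stressInner C L₀) (admStresses C)

/-- The projector `P_{E_0}` of `H_e`. -/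
def projCompat (C : UnitCell d) (L₀ : Tensor4 d) : TField C → TField C :=
  orthProj (strainInner C L₀) (compatFields C)

/-- The projector `P_{S^⊥}` of `H_s`. -/
def projStressOrth (C : UnitCell d) (L₀ : Tensor4 d) : TField C → TField C :=
  orthProj (stressInner C L₀) (admStressesOrth C L₀)

/-- The Eshelby problem with datum `τ`: `e ∈ E_0` and `L₀ e - τ ∈ S`. -/
def IsEshelbySolution (C : UnitCell d) (L₀ : Tensor4 d) (τ e : TField C) : Prop :=
  e ∈ compatFields C ∧ L₀.compLp e - τ ∈ admStresses C

open Classical in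
/-- The periodic strain Green's operator `Γ₀`: it maps `τ` to the solution of the Eshelby problem
(and to `0` where there is none). -/
def green (C : UnitCell d) (L₀ : Tensor4 d) (τ : TField C) : TField C :=
  if h : ∃ e, IsEshelbySolution C L₀ τ e then h.choose else 0

/-- The elasticity tensor of the composite: measurable on the cell, with major and minor
symmetries, bounded and uniformly positive definite almost everywhere. -/
def IsElasticity (C : UnitCell d) (L : Space d → Tensor4 d) : Prop :=
  AEStronglyMeasurable L C.meas ∧
    ∃ α β : ℝ, 0 < α ∧ ∀ᵐ x ∂C.meas, (L x).MajorSymm ∧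
      ∀ a : SymTensor d, α * ‖a‖ ^ 2 ≤ inner ℝ (L x a) a ∧ inner ℝ (L x a) a ≤ β * ‖a‖ ^ 2

/-- The strain-compatibility error `½ ‖(I - P_{E_0}) η - ε̄‖²`. -/
def errCompat (C : UnitCell d) (L₀ : Tensor4 d) (εbar : SymTensor d) (η : TField C) : ℝ :=
  (1 / 2) * strainInner C L₀ (η - projCompat C L₀ η - Lp.const 2 C.meas εbar)
    (η - projCompat C L₀ η - Lp.const 2 C.meas εbar)

/-- The local error in constitutive relation `½ L e : e + ½ s : L⁻¹ s - s : e`, where `L`, `s`,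
`e` are the values at a point. -/
def ecr (A : Tensor4 d) (s e : SymTensor d) : ℝ :=
  (1 / 2) * inner ℝ (A e) e + (1 / 2) * inner ℝ s (A.inverse s) - inner ℝ s e

/-- The error in constitutive relation: the average of `ecr` over the cell. -/
def errConst (C : UnitCell d) (L : Space d → Tensor4 d) (τ η : TField C) : ℝ :=
  ⨍ x in C.cell, ecr (L x) (τ x) (η x)

/-- The equilibrium error `½ ‖P_{S^⊥} τ‖²`. -/
def errEquil (C : UnitCell d) (L₀ : Tensor4 d) (τ : TField C) : ℝ :=
  (1 / 2) * stressInner C L₀ (projStressOrth C L₀ τ) (projStressOrth C L₀ τ)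

/-- The two-field functional `P(τ, η)`. -/
def costP (C : UnitCell d) (L₀ : Tensor4 d) (L : Space d → Tensor4 d) (εbar : SymTensor d)
    (τ η : TField C) : ℝ :=
  errCompat C L₀ εbar η + errConst C L τ η + errEquil C L₀ τ

/-- `g` is the gradient of `F` at `v` for the scalar product `ip`: `ip g v'` is the directional
derivative of `F` at `v` in every direction `v'`. -/
def IsGradAt {H : Type*} [AddCommGroup H] [Module ℝ H] (ip : H → H → ℝ) (F : H → ℝ)
    (v g : H) : Prop :=
  ∀ v' : H, Tendsto (fun t : ℝ => (F (v + t • v') - F v) / t) (𝓝[≠] 0) (𝓝 (ip g v'))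

/-- `g` is the partial gradient `∇_τ P(σ, ε)` in `H_s`. -/
def IsStressGrad (C : UnitCell d) (L₀ : Tensor4 d) (L : Space d → Tensor4 d) (εbar : SymTensor d)
    (σ ε g : TField C) : Prop :=
  IsGradAt (stressInner C L₀) (fun τ => costP C L₀ L εbar τ ε) σ g

/-- `g` is the partial gradient `∇_η P(σ, ε)` in `H_e`. -/
def IsStrainGrad (C : UnitCell d) (L₀ : Tensor4 d) (L : Space d → Tensor4 d) (εbar : SymTensor d)
    (σ ε g : TField C) : Prop :=
  IsGradAt (strainInner C L₀) (fun η => costP C L₀ L εbar σ η) ε g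

/-- The periodic elasticity problem on the cell with prescribed macroscopic strain `εbar`:
`ε ∈ E` with average `εbar`, `σ = L ε` in the cell, `σ ∈ S`. -/
def IsElasticSolution (C : UnitCell d) (L : Space d → Tensor4 d) (εbar : SymTensor d)
    (σ ε : TField C) : Prop :=
  (ε ∈ admStrains C ∧ ⨍ x in C.cell, ε x = εbar) ∧
    (∀ᵐ x ∂C.meas, σ x = L x (ε x)) ∧ σ ∈ admStresses C

/-- The equations `σ = L ε` in the cell, `(I - Γ₀ L₀) ε = ε̄`, `Γ₀ σ = 0`. -/
def SatisfiesOptimalityEqs (C : UnitCell d) (L₀ : Tensor4 d) (L : Space d → Tensor4 d)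
    (εbar : SymTensor d) (σ ε : TField C) : Prop :=
  (∀ᵐ x ∂C.meas, σ x = L x (ε x)) ∧
    ε - green C L₀ (L₀.compLp ε) = Lp.const 2 C.meas εbar ∧ green C L₀ σ = 0

end

end PeriodicElasticity

open PeriodicElasticity

/-! The core is a duality: for the plain `L²` product on the cell, `E_0` and `S` are each the
orthogonal complement of the other (`mem_admStresses_iff`, `mem_compatFields_iff`). Granted this,
everything else is Hilbert space algebra.

Write `A` and `B` for multiplication by `L₀` and `L`, and `G` for the Green operator: `G τ` is the
element of `E_0` for which `A (G τ) - τ` is orthogonal to `E_0`, and Lax–Milgram provides it. By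
duality `P_{E_0} = G A` and `P_{S^⊥} = A G`. Completing the square pointwise then makes `P`, up to
the positive factor 1 / |cell|, a sum of three squares: of `η - G A η - ε̄` and `G τ` in the
`A`-norm, and of `η - B⁻¹ τ` in the `B`-norm (`energy`). The energy vanishes exactly when the three
equations hold. They say `η - ε̄ ∈ E_0`, `τ = B η` and `τ ⊥ E_0`, which is the elasticity problem,
and Lax–Milgram for `B` solves it uniquely. The minimum is therefore zero and attained once. At a
critical point, taking the difference to the solution as the direction shows that the energy is
zero.

Three analytic facts carry the duality. A field orthogonal to all smooth periodic strains is
divergence-free, because test functions on the whole space can be periodized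
(`mem_admStresses_of_orthogonal`). A weakly divergence-free `L²` field is orthogonal to `H¹`
gradients, by mollification (`sum_setIntegral_mul_eq_zero`). Limits of smooth strains are again
compatible, by the Korn and Poincaré inequalities (`mem_compatFields_of_tendsto`). -/

namespace PeriodicElasticity

open MeasureTheory Filter Topology
open scoped ContDiff ENNReal

/-! ### Lattice-periodic functions and their integrals over a cell -/

section Periodic

open scoped Pointwise

variable {d : ℕ}

/-- The lattice of periods. -/
abbrev UnitCell.lattice (C : UnitCell d) : AddSubgroup (Space d) :=
  (Submodule.span ℤ (Set.range C.Y)).toAddSubgroup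

instance UnitCell.countable_lattice (C : UnitCell d) : Countable C.lattice :=
  inferInstanceAs (Countable (Submodule.span ℤ (Set.range C.Y)))

/-- The half-open parallelepiped spanned by the periods. -/
abbrev UnitCell.box (C : UnitCell d) : Set (Space d) := ZSpan.fundamentalDomain C.Y

theorem UnitCell.box_tiles (C : UnitCell d) :
    IsAddFundamentalDomain C.lattice C.box (volume : Measure (Space d)) :=
  ZSpan.isAddFundamentalDomain' C.Y volume

/-- `f` is invariant under the lattice translations. -/
def IsPer (C : UnitCell d) {β : Type*} (f : Space d → β) : Prop :=
  ∀ Y ∈ C.lattice, ∀ x, f (x + Y) = f x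

variable {C : UnitCell d}

theorem IsPer.vadd {β : Type*} {f : Space d → β} (hf : IsPer C f) (g : C.lattice) (x : Space d) :
    f (g +ᵥ x) = f x := by
  rw [show g +ᵥ x = x + (g : Space d) from add_comm _ _]
  exact hf g g.2 x

theorem IsPer.fract {β : Type*} {f : Space d → β} (hf : IsPer C f) (x : Space d) :
    f (ZSpan.fract C.Y x) = f x := by
  rw [ZSpan.fract_apply, sub_eq_add_neg]
  exact hf _ (C.lattice.neg_mem (ZSpan.floor C.Y x).2) x

theorem UnitCell.exists_box_subset_ball (C : UnitCell d) : ∃ R : ℝ, 0 < R ∧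
    ∀ x ∈ C.box, ‖x‖ < R := by
  obtain ⟨R, hR⟩ := (ZSpan.fundamentalDomain_isBounded C.Y).exists_norm_le
  refine ⟨|R| + 1, by positivity, fun x hx => ?_⟩
  have := hR x hx
  have := le_abs_self R
  linarith

theorem UnitCell.volume_cell_ne_zero (C : UnitCell d) : (volume C.cell) ≠ 0 := by
  rw [C.tiles.measure_eq C.box_tiles]
  exact ZSpan.measure_fundamentalDomain_ne_zero C.Y

theorem UnitCell.volume_cell_ne_top (C : UnitCell d) : (volume C.cell) ≠ ⊤ := by
  rw [C.tiles.measure_eq C.box_tiles]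
  exact (ZSpan.fundamentalDomain_isBounded C.Y).measure_lt_top.ne

/-- Only finitely many lattice translations do not move a given ball away from a given bounded
set. -/
theorem UnitCell.exists_finset_lattice (C : UnitCell d) (R : ℝ) {K : Set (Space d)}
    (hK : Bornology.IsBounded K) :
    ∃ s : Finset C.lattice, ∀ x : Space d, ‖x‖ < R → ∀ Y : C.lattice, x + (Y : Space d) ∈ K →
      Y ∈ s := by
  obtain ⟨R', hR'⟩ := hK.exists_norm_le
  have hfin := ZSpan.setFinite_inter C.Y
    (Metric.isBounded_closedBall (x := (0 : Space d)) (r := R' + R))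
  have hfin' : Set.Finite {Y : C.lattice | ‖(Y : Space d)‖ ≤ R' + R} := by
    refine Set.Finite.of_finite_image (f := Subtype.val) (hfin.subset ?_)
      Subtype.val_injective.injOn
    rintro _ ⟨Y, hY, rfl⟩
    exact ⟨by simpa using hY, Y.2⟩
  refine ⟨hfin'.toFinset, fun x hx Y hY => ?_⟩
  simp only [Set.Finite.mem_toFinset, Set.mem_ofPred_eq]
  have h1 := hR' _ hY
  have h2 : ‖(Y : Space d)‖ ≤ ‖x + (Y : Space d)‖ + ‖x‖ := by
    simpa using norm_sub_le (x + (Y : Space d)) x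
  linarith

/-- A bounded set is covered by finitely many translates of the box. -/
theorem UnitCell.exists_finset_cover (C : UnitCell d) {K : Set (Space d)}
    (hK : Bornology.IsBounded K) :
    ∃ s : Finset C.lattice, K ⊆ ⋃ Y ∈ s, Y +ᵥ C.box := by
  obtain ⟨R, -, hR⟩ := C.exists_box_subset_ball
  obtain ⟨s, hs⟩ := C.exists_finset_lattice R hK
  refine ⟨s, fun x hx => ?_⟩
  have hmem := ZSpan.fract_mem_fundamentalDomain C.Y x
  let Y : C.lattice := ZSpan.floor C.Y x
  have hxY : ZSpan.fract C.Y x + (Y : Space d) = x := by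
    simp [Y, ZSpan.fract_apply]
  have := hs _ (hR _ hmem) Y (by rwa [hxY])
  simp only [Set.mem_iUnion]
  refine ⟨Y, this, ZSpan.fract C.Y x, hmem, ?_⟩
  change (Y : Space d) + ZSpan.fract C.Y x = x
  rw [add_comm, hxY]

theorem IsPer.integrableOn_of_isBounded {f : Space d → ℝ} (hf : IsPer C f)
    (hi : Integrable f C.meas) {K : Set (Space d)} (hK : Bornology.IsBounded K) :
    IntegrableOn f K volume := by
  obtain ⟨s, hs⟩ := C.exists_finset_cover hK
  refine IntegrableOn.mono_set ?_ hs
  rw [integrableOn_finset_iUnion]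
  intro Y _
  exact ((C.box_tiles.vadd Y).integrableOn_iff C.tiles hf.vadd).2 hi

theorem IsPer.locallyIntegrable {f : Space d → ℝ} (hf : IsPer C f)
    (hi : Integrable f C.meas) : LocallyIntegrable f volume := by
  rw [locallyIntegrable_iff]
  exact fun K hK => hf.integrableOn_of_isBounded hi hK.isBounded

theorem IsPer.setIntegral_box {f : Space d → ℝ} (hf : IsPer C f) :
    ∫ x in C.box, f x = ∫ x in C.cell, f x :=
  C.box_tiles.setIntegral_eq C.tiles hf.vadd

/-- The translated cell is another fundamental domain, and a periodic function has the same integral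
over all of them. -/
theorem IsPer.integral_translate {f : Space d → ℝ} (hf : IsPer C f) (h : Space d) :
    ∫ x in C.cell, f (x + h) = ∫ x in C.cell, f x := by
  have h1 : IsAddFundamentalDomain C.lattice (h +ᵥ C.cell) (volume : Measure (Space d)) :=
    C.tiles.vadd_of_comm h
  rw [← h1.setIntegral_eq C.tiles hf.vadd]
  have := (measurePreserving_vadd h (volume : Measure (Space d))).setIntegral_image_emb
    (measurableEmbedding_const_vadd _) f C.cell
  simp only [add_comm _ h]
  exact this.symm

theorem IsPer.translate {β : Type*} {f : Space d → β} (hf : IsPer C f) (h : Space d) :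
    IsPer C (fun x => f (x + h)) := by
  intro Y hY x
  simp only [add_right_comm x Y h]
  exact hf Y hY _

theorem IsPer.comp {β γ : Type*} {f : Space d → β} (hf : IsPer C f) (g : β → γ) :
    IsPer C (fun x => g (f x)) := fun Y hY x => congrArg g (hf Y hY x)

theorem IsPer.comp₂ {β γ δ : Type*} {f : Space d → β} {f' : Space d → γ} (hf : IsPer C f)
    (hf' : IsPer C f') (g : β → γ → δ) : IsPer C (fun x => g (f x) (f' x)) := fun Y hY x => by
  simp only [hf Y hY x, hf' Y hY x]

theorem IsPer.exists_bound {f : Space d → ℝ} (hf : IsPer C f) (hc : Continuous f) :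
    ∃ M : ℝ, ∀ x, |f x| ≤ M := by
  obtain ⟨R, -, hR⟩ := C.exists_box_subset_ball
  obtain ⟨M, hM⟩ := (isCompact_closedBall (0 : Space d) R).exists_bound_of_continuousOn
    hc.continuousOn
  refine ⟨M, fun x => ?_⟩
  rw [← hf.fract x]
  exact hM _ (by simpa using (hR _ (ZSpan.fract_mem_fundamentalDomain C.Y x)).le)

theorem IsPer.integrable {f : Space d → ℝ} (hf : IsPer C f) (hc : Continuous f) :
    Integrable f C.meas := by
  obtain ⟨M, hM⟩ := hf.exists_bound hc
  exact Integrable.of_bound hc.aestronglyMeasurable M (Eventually.of_forall hM)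

theorem IsPer.memLp_two {f : Space d → ℝ} (hf : IsPer C f) (hc : Continuous f) :
    MemLp f 2 C.meas := by
  obtain ⟨M, hM⟩ := hf.exists_bound hc
  exact MemLp.of_bound hc.aestronglyMeasurable M (Eventually.of_forall hM)

end Periodic

/-! ### Periodization of test functions -/

section Periodization

variable {d : ℕ}

/-- The sum of the lattice translates of `φ`. -/
noncomputable def periodize (C : UnitCell d) (φ : Space d → ℝ) (x : Space d) : ℝ :=
  ∑' Y : C.lattice, φ (x + Y)

variable {C : UnitCell d} {φ : Space d → ℝ}

theorem isPer_periodize (C : UnitCell d) (φ : Space d → ℝ) : IsPer C (periodize C φ) := by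
  intro Y hY x
  unfold periodize
  rw [← (Equiv.addLeft (⟨Y, hY⟩ : C.lattice)).tsum_eq fun Z : C.lattice => φ (x + (Z : Space d))]
  simp [add_assoc]

/-- One finite index set serves a whole ball, so near any point the series is a finite sum.
Continuity, smoothness and termwise differentiation of the periodization follow from this. -/
theorem exists_periodize_eq_sum (C : UnitCell d) (hφ : HasCompactSupport φ) (R : ℝ) :
    ∃ s : Finset C.lattice, (∀ x : Space d, ‖x‖ < R → ∀ Y ∉ s, φ (x + (Y : Space d)) = 0) ∧
      ∀ x : Space d, ‖x‖ < R → periodize C φ x = ∑ Y ∈ s, φ (x + (Y : Space d)) := by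
  obtain ⟨s, hs⟩ := C.exists_finset_lattice R hφ.isCompact.isBounded
  have h0 : ∀ x : Space d, ‖x‖ < R → ∀ Y ∉ s, φ (x + (Y : Space d)) = 0 := by
    intro x hx Y hY
    by_contra hne
    exact hY (hs x hx Y (subset_tsupport _ hne))
  exact ⟨s, h0, fun x hx => tsum_eq_sum (h0 x hx)⟩

theorem eventually_norm_lt (x : Space d) : ∀ᶠ y in 𝓝 x, ‖y‖ < ‖x‖ + 1 :=
  continuous_norm.continuousAt.eventually (gt_mem_nhds (by simp))

theorem contDiff_periodize (hφ : ContDiff ℝ ∞ φ) (hc : HasCompactSupport φ) :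
    ContDiff ℝ ∞ (periodize C φ) := by
  rw [contDiff_iff_contDiffAt]
  intro x
  obtain ⟨s, -, hs⟩ := exists_periodize_eq_sum C hc (‖x‖ + 1)
  refine ContDiffAt.congr_of_eventuallyEq (f := fun y => ∑ Y ∈ s, φ (y + (Y : Space d))) ?_
    ((eventually_norm_lt x).mono hs)
  exact (ContDiff.sum fun Y _ => hφ.comp (contDiff_id.add contDiff_const)).contDiffAt

theorem continuous_pderiv {φ : Space d → ℝ} (hφ : ContDiff ℝ ∞ φ) (j : Fin d) :
    Continuous (pderiv j φ) := by
  unfold pderiv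
  exact (hφ.continuous_fderiv (by simp)).clm_apply continuous_const

theorem contDiff_pderiv {φ : Space d → ℝ} (hφ : ContDiff ℝ ∞ φ) (j : Fin d) :
    ContDiff ℝ ∞ (pderiv j φ) := by
  unfold pderiv
  exact (hφ.fderiv_right (m := ∞) (by simp)).clm_apply contDiff_const

theorem hasCompactSupport_pderiv {φ : Space d → ℝ} (hφ : HasCompactSupport φ) (j : Fin d) :
    HasCompactSupport (pderiv j φ) :=
  hφ.fderiv_apply (𝕜 := ℝ) _

theorem pderiv_comp_add (φ : Space d → ℝ) (h x : Space d) (j : Fin d) :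
    pderiv j (fun y => φ (y + h)) x = pderiv j φ (x + h) := by
  unfold pderiv
  rw [fderiv_comp_add_right]

theorem IsPer.partialDeriv {f : Space d → ℝ} (hf : IsPer C f) (j : Fin d) :
    IsPer C (pderiv j f) := by
  intro Y hY x
  rw [← pderiv_comp_add]
  congr 1
  ext y
  exact hf Y hY y

theorem pderiv_periodize (hφ : ContDiff ℝ ∞ φ) (hc : HasCompactSupport φ) (j : Fin d) :
    pderiv j (periodize C φ) = periodize C (pderiv j φ) := by
  ext x
  obtain ⟨s, h0, hs⟩ := exists_periodize_eq_sum C hc (‖x‖ + 1)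
  have hx : ‖x‖ < ‖x‖ + 1 := by simp
  have h1 : pderiv j (periodize C φ) x = ∑ Y ∈ s, pderiv j φ (x + (Y : Space d)) := by
    have hd : ∀ Y ∈ s, DifferentiableAt ℝ (fun y => φ (y + (Y : Space d))) x := fun Y _ =>
      ((hφ.comp (contDiff_id.add contDiff_const)).differentiable (by simp)) x
    have : fderiv ℝ (periodize C φ) x = ∑ Y ∈ s, fderiv ℝ (fun y => φ (y + (Y : Space d))) x := by
      rw [← fderiv_fun_sum hd]
      exact Filter.EventuallyEq.fderiv_eq ((eventually_norm_lt x).mono hs)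
    unfold pderiv
    rw [this, _root_.sum_apply]
    simp only [fderiv_comp_add_right]
  rw [h1]
  refine (tsum_eq_sum fun Y hY => ?_).symm
  rw [← pderiv_comp_add]
  have : (fun y => φ (y + (Y : Space d))) =ᶠ[𝓝 x] fun _ => 0 :=
    (eventually_norm_lt x).mono fun y hy => h0 y hy Y hY
  unfold pderiv
  rw [this.fderiv_eq]
  simp

theorem continuous_periodize (hφ : Continuous φ) (hc : HasCompactSupport φ) :
    Continuous (periodize C φ) := by
  rw [continuous_iff_continuousAt]
  intro x
  obtain ⟨s, -, hs⟩ := exists_periodize_eq_sum C hc (‖x‖ + 1)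
  refine ContinuousAt.congr (f := fun y => ∑ Y ∈ s, φ (y + (Y : Space d))) ?_
    (((eventually_norm_lt x).mono hs).mono fun _ h => h.symm)
  exact (continuous_finsetSum _ fun Y _ => hφ.comp (continuous_id.add continuous_const)).continuousAt

theorem LocallyIntegrable.integrable_mul_of_hasCompactSupport {f : Space d → ℝ}
    (hf : LocallyIntegrable f volume) (hφ : Continuous φ) (hc : HasCompactSupport φ) :
    Integrable (fun x => f x * φ x) volume := by
  have := hf.integrable_smul_right_of_hasCompactSupport hφ hc
  simpa [smul_eq_mul] using this

/-- Unfolding of an integral over the space into an integral over the cell. -/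
theorem integral_mul_eq_setIntegral_periodize {f : Space d → ℝ} (hf : IsPer C f)
    (hi : Integrable f C.meas) (hφ : Continuous φ) (hc : HasCompactSupport φ) :
    ∫ x, f x * φ x = ∫ x in C.cell, f x * periodize C φ x := by
  have hint := LocallyIntegrable.integrable_mul_of_hasCompactSupport (hf.locallyIntegrable hi) hφ hc
  -- The given cell may be unbounded. The computation is made on the bounded box, where the
  -- periodization is a single finite sum, and is carried to the cell by periodicity.
  obtain ⟨R, -, hR⟩ := C.exists_box_subset_ball
  obtain ⟨s, h0, hs⟩ := exists_periodize_eq_sum C hc R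
  have hbox : MeasurableSet C.box := ZSpan.fundamentalDomain_measurableSet C.Y
  have hfb : IntegrableOn f C.box volume := (C.box_tiles.integrableOn_iff C.tiles hf.vadd).2 hi
  rw [← (hf.comp₂ (isPer_periodize C φ) (· * ·)).setIntegral_box,
    C.box_tiles.integral_eq_tsum'' _ hint]
  have e1 : ∀ Y : C.lattice, ∫ x in C.box, f (Y +ᵥ x) * φ (Y +ᵥ x) =
      ∫ x in C.box, f x * φ (x + (Y : Space d)) := by
    intro Y
    refine integral_congr_ae (Eventually.of_forall fun x => ?_)
    simp only [hf.vadd]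
    rw [show Y +ᵥ x = x + (Y : Space d) from add_comm _ _]
  simp only [e1]
  rw [tsum_eq_sum (s := s), ← integral_finsetSum]
  · refine setIntegral_congr_fun hbox fun x hx => ?_
    simp only [hs x (hR x hx), Finset.mul_sum]
  · intro Y _
    obtain ⟨M, hM⟩ := hφ.bounded_above_of_compact_support hc
    exact hfb.mul_bdd (c := M) (hφ.comp (continuous_id.add continuous_const)).aestronglyMeasurable
      (Eventually.of_forall fun x => hM _)
  · intro Y hY
    rw [setIntegral_congr_fun (g := fun _ => (0 : ℝ)) hbox fun x hx => by
      simp [h0 x (hR x hx) Y hY]]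
    simp

/-- A smooth compactly supported partition of unity subordinate to the lattice. -/
theorem exists_cutoff (C : UnitCell d) : ∃ χ : Space d → ℝ, ContDiff ℝ ∞ χ ∧
    HasCompactSupport χ ∧ ∀ x, periodize C χ x = 1 := by
  obtain ⟨R, hR0, hR⟩ := C.exists_box_subset_ball
  -- The bump equals 1 on a ball containing the box, so its periodization is positive everywhere.
  -- Dividing by that periodic function normalises the sum of translates to 1.
  let ψ : ContDiffBump (0 : Space d) := ⟨R, R + 1, hR0, by linarith⟩
  have hψ : ContDiff ℝ ∞ ψ := ψ.contDiff
  have hψc : HasCompactSupport ψ := ψ.hasCompactSupport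
  have hpos : ∀ x, 0 < periodize C ψ x := by
    intro x
    rw [← (isPer_periodize C ψ).fract x]
    set y := ZSpan.fract C.Y x
    have hy : ‖y‖ < R := hR _ (ZSpan.fract_mem_fundamentalDomain C.Y x)
    obtain ⟨s, h0, hs⟩ := exists_periodize_eq_sum C hψc R
    have hone : ψ y = 1 := ψ.one_of_mem_closedBall (by simpa using hy.le)
    have hmem : (0 : C.lattice) ∈ s := by
      by_contra hn
      have := h0 y hy 0 hn
      simp [hone] at this
    rw [hs y hy]
    refine Finset.sum_pos' (fun Y _ => ψ.nonneg) ⟨0, hmem, ?_⟩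
    simp [hone]
  refine ⟨fun x => ψ x / periodize C ψ x, hψ.div (contDiff_periodize hψ hψc)
    fun x => (hpos x).ne', ?_, fun x => ?_⟩
  · simp only [div_eq_mul_inv]
    exact hψc.mul_right
  · have : ∀ Y : C.lattice, ψ (x + (Y : Space d)) / periodize C ψ (x + (Y : Space d)) =
        ψ (x + (Y : Space d)) / periodize C ψ x := fun Y => by
      rw [isPer_periodize C ψ Y Y.2 x]
    simp only [periodize] at this ⊢
    simp only [this, tsum_div_const]
    exact div_self (hpos x).ne'

/-- This turns an integral over the cell into one over the whole space with a compactly supported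
weight, the setting in which weak derivatives are tested. -/
theorem integral_mul_cutoff {f χ : Space d → ℝ} (hf : IsPer C f) (hi : Integrable f C.meas)
    (hχ : ContDiff ℝ ∞ χ) (hc : HasCompactSupport χ) (h1 : ∀ x, periodize C χ x = 1) :
    ∫ x, f x * χ x = ∫ x in C.cell, f x := by
  rw [integral_mul_eq_setIntegral_periodize hf hi hχ.continuous hc]
  simp [h1]

/-- The periodization of the derivative of `χ` is the derivative of the constant 1. Hence the cutoff
leaves no error term in integrations by parts. -/
theorem integral_mul_pderiv_cutoff {f χ : Space d → ℝ} (hf : IsPer C f) (hi : Integrable f C.meas)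
    (hχ : ContDiff ℝ ∞ χ) (hc : HasCompactSupport χ) (h1 : ∀ x, periodize C χ x = 1)
    (j : Fin d) : ∫ x, f x * pderiv j χ x = 0 := by
  rw [integral_mul_eq_setIntegral_periodize hf hi (continuous_pderiv hχ j)
    (hasCompactSupport_pderiv hc j), ← pderiv_periodize hχ hc]
  have : periodize C χ = fun _ => 1 := funext h1
  simp [this, pderiv]

end Periodization

end PeriodicElasticity

namespace PeriodicElasticity

open MeasureTheory Filter Topology
open scoped ContDiff ENNReal

/-! ### Korn and Poincaré inequalities for smooth periodic functions -/

section Smooth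

variable {d : ℕ}

theorem integral_mul_pderiv {f φ : Space d → ℝ} (hf : ContDiff ℝ ∞ f) (hφ : ContDiff ℝ ∞ φ)
    (hc : HasCompactSupport φ) (j : Fin d) :
    ∫ x, f x * pderiv j φ x = -∫ x, pderiv j f x * φ x := by
  have hint : ∀ {g ψ : Space d → ℝ}, Continuous g → Continuous ψ → HasCompactSupport ψ →
      Integrable (fun x => g x * ψ x) volume := fun hg hψ hψc =>
    LocallyIntegrable.integrable_mul_of_hasCompactSupport hg.locallyIntegrable hψ hψc
  exact integral_mul_fderiv_eq_neg_fderiv_mul_of_integrable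
    (hint (continuous_pderiv hf j) hφ.continuous hc)
    (hint hf.continuous (continuous_pderiv hφ j) (hasCompactSupport_pderiv hc j))
    (hint hf.continuous hφ.continuous hc)
    (fun x _ => hf.differentiable (by simp) x) (fun x _ => hφ.differentiable (by simp) x)

theorem pderiv_mul {f g : Space d → ℝ} (hf : ContDiff ℝ ∞ f) (hg : ContDiff ℝ ∞ g) (j : Fin d)
    (x : Space d) :
    pderiv j (fun y => f y * g y) x = f x * pderiv j g x + pderiv j f x * g x := by
  unfold pderiv
  rw [fderiv_fun_mul (hf.differentiable (by simp) x) (hg.differentiable (by simp) x)]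
  simp [mul_comm (g x)]

theorem pderiv_sub {f g : Space d → ℝ} (hf : ContDiff ℝ ∞ f) (hg : ContDiff ℝ ∞ g) (j : Fin d)
    (x : Space d) :
    pderiv j (fun y => f y - g y) x = pderiv j f x - pderiv j g x := by
  unfold pderiv
  rw [fderiv_fun_sub (hf.differentiable (by simp) x) (hg.differentiable (by simp) x)]
  simp

theorem pderiv_comm {f : Space d → ℝ} (hf : ContDiff ℝ ∞ f) (i j : Fin d) :
    pderiv i (pderiv j f) = pderiv j (pderiv i f) := by
  ext x
  have hd : DifferentiableAt ℝ (fderiv ℝ f) x :=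
    (hf.fderiv_right (m := ∞) (by simp)).differentiable (by simp) x
  have key : ∀ v w : Space d, fderiv ℝ (fun y => fderiv ℝ f y v) x w =
      fderiv ℝ (fderiv ℝ f) x w v := by
    intro v w
    rw [fderiv_clm_apply hd (differentiableAt_const v)]
    simp
  unfold pderiv
  rw [key, key]
  exact (hf.contDiffAt.isSymmSndFDerivAt (by simpa using WithTop.coe_le_coe.2 (le_top : (2 : ℕ∞) ≤ ⊤))).eq _ _

variable {C : UnitCell d}

/-- Smooth periodic functions. -/
structure SmoothPer (C : UnitCell d) (f : Space d → ℝ) : Prop where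
  smooth : ContDiff ℝ ∞ f
  per : IsPer C f

theorem SmoothPer.partialDeriv {f : Space d → ℝ} (hf : SmoothPer C f) (j : Fin d) :
    SmoothPer C (pderiv j f) :=
  ⟨contDiff_pderiv hf.smooth j, hf.per.partialDeriv j⟩

theorem SmoothPer.mul {f g : Space d → ℝ} (hf : SmoothPer C f) (hg : SmoothPer C g) :
    SmoothPer C (fun x => f x * g x) :=
  ⟨hf.smooth.mul hg.smooth, hf.per.comp₂ hg.per (· * ·)⟩

theorem SmoothPer.sub {f g : Space d → ℝ} (hf : SmoothPer C f) (hg : SmoothPer C g) :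
    SmoothPer C (fun x => f x - g x) :=
  ⟨hf.smooth.sub hg.smooth, hf.per.comp₂ hg.per (· - ·)⟩

theorem SmoothPer.integrable {f : Space d → ℝ} (hf : SmoothPer C f) : Integrable f C.meas :=
  hf.per.integrable hf.smooth.continuous

theorem SmoothPer.memLp_two {f : Space d → ℝ} (hf : SmoothPer C f) : MemLp f 2 C.meas :=
  hf.per.memLp_two hf.smooth.continuous

theorem smoothPer_periodize {φ : Space d → ℝ} (hφ : ContDiff ℝ ∞ φ) (hc : HasCompactSupport φ) :
    SmoothPer C (periodize C φ) :=
  ⟨contDiff_periodize hφ hc, isPer_periodize C φ⟩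

/-- Weighting by the cutoff and integrating by parts on the whole space moves the derivative onto
the cutoff, where it contributes nothing. No regularity of the boundary of the cell is needed. -/
theorem SmoothPer.integral_partialDeriv {f : Space d → ℝ} (hf : SmoothPer C f) (j : Fin d) :
    ∫ x in C.cell, pderiv j f x = 0 := by
  obtain ⟨χ, hχ, hc, h1⟩ := exists_cutoff C
  rw [← integral_mul_cutoff (hf.partialDeriv j).per (hf.partialDeriv j).integrable hχ hc h1, ← neg_eq_zero,
    ← integral_mul_pderiv hf.smooth hχ hc]
  exact integral_mul_pderiv_cutoff hf.per hf.integrable hχ hc h1 j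

theorem SmoothPer.integral_mul_partialDeriv {f g : Space d → ℝ} (hf : SmoothPer C f)
    (hg : SmoothPer C g) (j : Fin d) :
    ∫ x in C.cell, f x * pderiv j g x =
      -∫ x in C.cell, pderiv j f x * g x := by
  have h := (hf.mul hg).integral_partialDeriv j
  simp only [pderiv_mul hf.smooth hg.smooth] at h
  rw [integral_add (hf.mul (hg.partialDeriv j)).integrable ((hf.partialDeriv j).mul hg).integrable] at h
  linarith

/-- Korn's inequality for smooth periodic fields. -/
theorem korn {w : Fin d → Space d → ℝ} (hw : ∀ i, SmoothPer C (w i)) :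
    ∑ i, ∑ j, ∫ x in C.cell, pderiv j (w i) x ^ 2 ≤
      2 * ∑ i, ∑ j, ∫ x in C.cell, ((1 / 2) * (pderiv j (w i) x + pderiv i (w j) x)) ^ 2 := by
  have hI : ∀ i j k l, Integrable (fun x => pderiv j (w i) x * pderiv k (w l) x) C.meas :=
    fun i j k l => (((hw i).partialDeriv j).mul ((hw l).partialDeriv k)).integrable
  -- Two integrations by parts and the symmetry of second derivatives turn the cross terms of the
  -- squared strain into the square of the divergence. Dropping that nonnegative square gives the
  -- constant 2.
  have hswap : ∀ i j, ∫ x in C.cell, pderiv j (w i) x * pderiv i (w j) x =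
      ∫ x in C.cell, pderiv i (w i) x * pderiv j (w j) x := by
    intro i j
    rw [← neg_inj, ← (hw i).integral_mul_partialDeriv ((hw j).partialDeriv i), pderiv_comm (hw j).smooth,
      (hw i).integral_mul_partialDeriv ((hw j).partialDeriv j)]
  have hdiv : 0 ≤ ∑ i, ∑ j, ∫ x in C.cell, pderiv j (w i) x * pderiv i (w j) x := by
    rw [Finset.sum_congr rfl fun i _ => Finset.sum_congr rfl fun j _ => hswap i j]
    have : ∑ i, ∑ j, ∫ x in C.cell, pderiv i (w i) x * pderiv j (w j) x =
        ∫ x in C.cell, (∑ i, pderiv i (w i) x) * ∑ j, pderiv j (w j) x := by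
      simp only [Finset.sum_mul_sum]
      rw [integral_finsetSum _ fun i _ => integrable_finsetSum _ fun j _ => hI i i j j]
      exact Finset.sum_congr rfl fun i _ => (integral_finsetSum _ fun j _ => hI i i j j).symm
    rw [this]
    exact integral_nonneg fun x => mul_self_nonneg _
  have hexp : ∀ i j, ∫ x in C.cell, ((1 / 2) * (pderiv j (w i) x + pderiv i (w j) x)) ^ 2 =
      (1 / 4) * (∫ x in C.cell, pderiv j (w i) x ^ 2) +
      (1 / 4) * (∫ x in C.cell, pderiv i (w j) x ^ 2) +
      (1 / 2) * ∫ x in C.cell, pderiv j (w i) x * pderiv i (w j) x := by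
    intro i j
    simp only [← integral_const_mul, pow_two]
    have h1 : Integrable (fun x => (1 / 4) * (pderiv j (w i) x * pderiv j (w i) x) +
        (1 / 4) * (pderiv i (w j) x * pderiv i (w j) x)) C.meas :=
      ((hI i j j i).const_mul _).add ((hI j i i j).const_mul _)
    rw [← integral_add ((hI i j j i).const_mul _) ((hI j i i j).const_mul _),
      ← integral_add h1 ((hI i j i j).const_mul _)]
    exact integral_congr_ae (Eventually.of_forall fun x => by ring)
  simp only [hexp, Finset.sum_add_distrib, ← Finset.mul_sum]
  rw [Finset.sum_comm (f := fun i j => ∫ x in C.cell, pderiv i (w j) x ^ 2)]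
  linarith

theorem fderiv_sq_le {f : Space d → ℝ} (y h : Space d) :
    (fderiv ℝ f y h) ^ 2 ≤ ‖h‖ ^ 2 * ∑ j, pderiv j f y ^ 2 := by
  have h1 : fderiv ℝ f y h = ∑ j, h j * pderiv j f y := by
    have : h = ∑ j, h j • EuclideanSpace.single j (1 : ℝ) := by
      ext i
      simp [Finset.sum_apply, Pi.single_apply]
    conv_lhs => rw [this]
    simp [pderiv]
  rw [h1, EuclideanSpace.real_norm_sq_eq]
  exact Finset.sum_mul_sq_le_sq_mul_sq _ _ _

/-- The variance of `g` on the unit interval is nonnegative. -/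
theorem sq_integral_unit_le {g : ℝ → ℝ} (hg : Continuous g) :
    (∫ t in Set.Ioc (0 : ℝ) 1, g t) ^ 2 ≤ ∫ t in Set.Ioc (0 : ℝ) 1, g t ^ 2 := by
  set m := ∫ t in Set.Ioc (0 : ℝ) 1, g t
  have i1 : Integrable g (volume.restrict (Set.Ioc (0 : ℝ) 1)) :=
    hg.integrableOn_Ioc
  have i2 : Integrable (fun t => g t ^ 2) (volume.restrict (Set.Ioc (0 : ℝ) 1)) :=
    (hg.pow 2).integrableOn_Ioc
  have h : 0 ≤ ∫ t in Set.Ioc (0 : ℝ) 1, (g t - m) ^ 2 := integral_nonneg fun t => sq_nonneg _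
  have e : ∫ t in Set.Ioc (0 : ℝ) 1, (g t - m) ^ 2 =
      (∫ t in Set.Ioc (0 : ℝ) 1, g t ^ 2) - 2 * m * m + m ^ 2 := by
    have : ∀ t, (g t - m) ^ 2 = g t ^ 2 - 2 * m * g t + m ^ 2 := fun t => by ring
    simp only [this]
    have i3 : Integrable (fun t => g t ^ 2 - 2 * m * g t) (volume.restrict (Set.Ioc (0 : ℝ) 1)) :=
      i2.sub (i1.const_mul _)
    rw [integral_add i3 (integrable_const _),
      integral_sub i2 (i1.const_mul _), integral_const_mul]
    simp [m]
  nlinarith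

/-- The increment is the integral of the derivative along the segment. After Cauchy–Schwarz and
Fubini, translation invariance makes the integral over the cell independent of the position on the
segment. -/
theorem SmoothPer.integral_translate_sub_sq_le {f : Space d → ℝ} (hf : SmoothPer C f)
    (h : Space d) :
    ∫ x in C.cell, (f (x + h) - f x) ^ 2 ≤
      ‖h‖ ^ 2 * ∫ x in C.cell, ∑ j, pderiv j f x ^ 2 := by
  set q : Space d → ℝ := fun x => ∑ j, pderiv j f x ^ 2 with hq
  have hqc : Continuous q := continuous_finsetSum _ fun j _ => (continuous_pderiv hf.smooth j).pow 2
  have hqp : IsPer C q := fun Y hY x => by simp only [hq, (hf.per.partialDeriv _) Y hY x]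
  have hdf : Continuous (fderiv ℝ f) := hf.smooth.continuous_fderiv (by simp)
  have hpt : ∀ x, (f (x + h) - f x) ^ 2 ≤
      ‖h‖ ^ 2 * ∫ t in Set.Ioc (0 : ℝ) 1, q (x + t • h) := by
    intro x
    have hder : ∀ t : ℝ, HasDerivAt (fun t : ℝ => f (x + t • h)) (fderiv ℝ f (x + t • h) h) t := by
      intro t
      have h1 : HasDerivAt (fun t : ℝ => x + t • h) h t := by
        simpa using ((hasDerivAt_id t).smul_const h).const_add x
      exact ((hf.smooth.differentiable (by simp) _).hasFDerivAt).comp_hasDerivAt t h1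
    have hcont : Continuous fun t : ℝ => fderiv ℝ f (x + t • h) h :=
      (hdf.comp (by fun_prop)).clm_apply continuous_const
    have hftc : ∫ t in Set.Ioc (0 : ℝ) 1, fderiv ℝ f (x + t • h) h = f (x + h) - f x := by
      rw [← intervalIntegral.integral_of_le zero_le_one,
        intervalIntegral.integral_eq_sub_of_hasDerivAt (fun t _ => hder t)
          (hcont.intervalIntegrable _ _)]
      simp
    rw [← hftc, ← integral_const_mul]
    refine (sq_integral_unit_le hcont).trans ?_
    have hqt : Continuous fun t : ℝ => ‖h‖ ^ 2 * q (x + t • h) :=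
      continuous_const.mul (hqc.comp (by fun_prop))
    exact integral_mono (hcont.pow 2).integrableOn_Ioc hqt.integrableOn_Ioc
      fun t => fderiv_sq_le _ _
  obtain ⟨M, hM⟩ := hqp.exists_bound hqc
  have hprod : Integrable (Function.uncurry fun (x : Space d) (t : ℝ) => q (x + t • h))
      (C.meas.prod (volume.restrict (Set.Ioc (0 : ℝ) 1))) :=
    Integrable.of_bound (hqc.comp (by fun_prop)).aestronglyMeasurable M
      (Eventually.of_forall fun p => hM _)
  calc ∫ x in C.cell, (f (x + h) - f x) ^ 2
      ≤ ∫ x in C.cell, ‖h‖ ^ 2 * ∫ t in Set.Ioc (0 : ℝ) 1, q (x + t • h) := by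
        refine integral_mono ?_ (hprod.integral_prod_left.const_mul _) hpt
        refine IsPer.integrable (((hf.per.translate h).comp₂ hf.per fun a b => (a - b) ^ 2)) ?_
        have := hf.smooth.continuous
        fun_prop
    _ = ‖h‖ ^ 2 * ∫ t in Set.Ioc (0 : ℝ) 1, ∫ x in C.cell, q (x + t • h) := by
        rw [integral_const_mul, integral_integral_swap hprod]
    _ = ‖h‖ ^ 2 * ∫ x in C.cell, q x := by
        simp only [hqp.integral_translate]
        simp

/-- The Poincaré inequality for smooth periodic functions. -/
theorem poincare (C : UnitCell d) : ∃ K : ℝ, 0 ≤ K ∧ ∀ f : Space d → ℝ, SmoothPer C f →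
    ∫ x in C.cell, f x = 0 →
    ∫ x in C.cell, f x ^ 2 ≤ K * ∑ j, ∫ x in C.cell, pderiv j f x ^ 2 := by
  obtain ⟨R, hR0, hR⟩ := C.exists_box_subset_ball
  -- The integral of `(f (x + h) - f x) ^ 2` over `x` in the cell and `h` in the box is computed in
  -- two ways. For mean-free `f` it is `2 * m` times the integral of `f ^ 2`, with `m` the volume.
  -- Since `‖h‖ < R` it is at most `m * R ^ 2` times the integral of the squared gradient. The
  -- constant `R ^ 2 / 2` would do. The shift `h` runs over the box because the box is bounded.
  refine ⟨R ^ 2, sq_nonneg R, fun f hf h0 => ?_⟩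
  have hbox : MeasurableSet C.box := ZSpan.fundamentalDomain_measurableSet C.Y
  have hvol : volume.real C.box = volume.real C.cell := by
    simp only [Measure.real, C.tiles.measure_eq C.box_tiles]
  have : IsFiniteMeasure (volume.restrict C.box) := ⟨by
    simpa using (ZSpan.fundamentalDomain_isBounded C.Y).measure_lt_top⟩
  set m := volume.real C.cell
  have hm : 0 < m := ENNReal.toReal_pos C.volume_cell_ne_zero C.volume_cell_ne_top
  have hfc := hf.smooth.continuous
  have hf2 : Integrable (fun x => f x ^ 2) C.meas := by
    simpa only [pow_two] using (hf.mul hf).integrable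
  have hq : ∑ j, ∫ x in C.cell, pderiv j f x ^ 2 = ∫ x in C.cell, ∑ j, pderiv j f x ^ 2 := by
    refine (integral_finsetSum _ fun j _ => ?_).symm
    simpa only [pow_two] using ((hf.partialDeriv j).mul (hf.partialDeriv j)).integrable
  rw [hq]
  set Q := ∫ x in C.cell, ∑ j, pderiv j f x ^ 2
  have hQ : 0 ≤ Q := integral_nonneg fun x => Finset.sum_nonneg fun j _ => sq_nonneg _
  obtain ⟨M, hM⟩ := hf.per.exists_bound hfc
  have hprod : Integrable (Function.uncurry fun (x h : Space d) => (f (x + h) - f x) ^ 2)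
      (C.meas.prod (volume.restrict C.box)) := by
    refine Integrable.of_bound (C := (M + M) ^ 2) ?_ (Eventually.of_forall fun p => ?_)
    · refine Continuous.aestronglyMeasurable ?_
      change Continuous fun p : Space d × Space d => (f (p.1 + p.2) - f p.1) ^ 2
      fun_prop
    · simp only [Function.uncurry, Real.norm_eq_abs, abs_pow]
      have := abs_sub (f (p.1 + p.2)) (f p.1)
      have := hM (p.1 + p.2)
      have := hM p.1
      gcongr
      linarith
  have hin : ∀ x, ∫ h in C.box, (f (x + h) - f x) ^ 2 =
      (∫ y in C.cell, f y ^ 2) + m * f x ^ 2 := by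
    intro x
    have hp : IsPer C fun h => (f (h + x) - f x) ^ 2 :=
      (hf.per.translate x).comp fun a => (a - f x) ^ 2
    simp only [add_comm x]
    rw [hp.setIntegral_box, (hf.per.comp fun a => (a - f x) ^ 2).integral_translate x]
    have : ∀ y, (f y - f x) ^ 2 = f y ^ 2 - 2 * f x * f y + f x ^ 2 := fun y => by ring
    simp only [this]
    have i3 : Integrable (fun y => f y ^ 2 - 2 * f x * f y) C.meas :=
      hf2.sub (hf.integrable.const_mul _)
    rw [integral_add i3 (integrable_const _),
      integral_sub hf2 (hf.integrable.const_mul _), integral_const_mul, h0]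
    simp [m]
  have h1 : ∫ x in C.cell, ∫ h in C.box, (f (x + h) - f x) ^ 2 =
      2 * m * ∫ x in C.cell, f x ^ 2 := by
    simp only [hin]
    rw [integral_add (integrable_const _) (hf2.const_mul _), integral_const_mul]
    simp [m]
    ring
  have h2 : ∫ x in C.cell, ∫ h in C.box, (f (x + h) - f x) ^ 2 ≤ m * (R ^ 2 * Q) := by
    rw [integral_integral_swap hprod]
    calc ∫ h in C.box, ∫ x in C.cell, (f (x + h) - f x) ^ 2
        ≤ ∫ h in C.box, R ^ 2 * Q := by
          refine setIntegral_mono_on hprod.integral_prod_right (integrable_const _) hbox ?_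
          intro h hh
          refine (hf.integral_translate_sub_sq_le h).trans ?_
          have := (hR h hh).le
          gcongr
      _ = m * (R ^ 2 * Q) := by
          simp [hvol]
  rw [h1] at h2
  have h3 : 0 ≤ ∫ x in C.cell, f x ^ 2 := integral_nonneg fun x => sq_nonneg _
  have h4 : m * (2 * ∫ x in C.cell, f x ^ 2) ≤ m * (R ^ 2 * Q) := by linarith
  have := le_of_mul_le_mul_left h4 hm
  linarith

end Smooth

end PeriodicElasticity

namespace PeriodicElasticity

open MeasureTheory Filter Topology
open scoped ContDiff ENNReal

/-! ### Periodic representatives and periodic extensions -/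

section Extension

open scoped Pointwise

variable {d : ℕ} {C : UnitCell d}

theorem IsPer.aestronglyMeasurable {f : Space d → ℝ} (hf : IsPer C f)
    (hm : AEStronglyMeasurable f C.meas) : AEStronglyMeasurable f volume := by
  rw [← C.tiles.sum_restrict, aestronglyMeasurable_sum_measure_iff]
  exact fun Y => ((C.tiles.vadd Y).aestronglyMeasurable_on_iff C.tiles hf.vadd).2 hm

theorem IsPer.memL2Per {f : Space d → ℝ} (hf : IsPer C f) (h2 : MemLp f 2 C.meas) :
    MemL2Per C f := by
  refine ⟨fun K hK => ?_, fun Y hY => Eventually.of_forall (hf Y hY)⟩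
  rw [memLp_two_iff_integrable_sq (hf.aestronglyMeasurable h2.1).restrict]
  exact (hf.comp (· ^ 2)).integrableOn_of_isBounded h2.integrable_sq hK.isBounded

/-- A periodic field agrees almost everywhere with an exactly periodic one. -/
theorem MemL2Per.exists_isPer {f : Space d → ℝ} (hf : MemL2Per C f) :
    ∃ f' : Space d → ℝ, f =ᵐ[volume] f' ∧ IsPer C f' ∧ MemLp f' 2 C.meas := by
  -- Reduction modulo the lattice makes `f` exactly periodic. It changes `f` only on a null set,
  -- because the lattice is countable and one null set serves all translations.
  have hper : IsPer C fun x => f (ZSpan.fract C.Y x) := fun Y hY x => by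
    simp only [ZSpan.fract_add_ZSpan C.Y x hY]
  have hae : f =ᵐ[volume] fun x => f (ZSpan.fract C.Y x) := by
    have hall : ∀ᵐ x : Space d, ∀ Y : C.lattice, f (x + Y) = f x :=
      ae_all_iff.2 fun Y => hf.2 Y Y.2
    filter_upwards [hall] with x hx
    have := hx (-(⟨ZSpan.floor C.Y x, (ZSpan.floor C.Y x).2⟩ : C.lattice))
    rw [ZSpan.fract_apply, sub_eq_add_neg]
    exact this.symm
  refine ⟨_, hae, hper, ?_⟩
  have hbox : MemLp (fun x => f (ZSpan.fract C.Y x)) 2 (volume.restrict C.box) := by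
    obtain ⟨R, -, hR⟩ := C.exists_box_subset_ball
    have h1 := hf.1 _ (isCompact_closedBall (0 : Space d) R)
    have h2 : MemLp f 2 (volume.restrict C.box) :=
      h1.mono_measure (Measure.restrict_mono (fun x hx => by simpa using (hR x hx).le) le_rfl)
    exact h2.ae_eq (ae_restrict_of_ae hae)
  have hm := (C.box_tiles.aestronglyMeasurable_on_iff C.tiles hper.vadd).1 hbox.1
  rw [memLp_two_iff_integrable_sq hm]
  exact (C.box_tiles.integrableOn_iff C.tiles (hper.comp (· ^ 2)).vadd).1 hbox.integrable_sq

/-- Translates of the cell overlap only in null sets, so at almost every point of the cell the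
periodized truncation of `f` has a single nonzero term at most. No measurability of `f` is involved.
-/
theorem exists_periodic_extension (C : UnitCell d) (f : Space d → ℝ) :
    ∃ f' : Space d → ℝ, IsPer C f' ∧ f' =ᵐ[C.meas] f := by
  refine ⟨periodize C (C.cell.indicator f), isPer_periodize C _, ?_⟩
  have hdisj : ∀ᵐ x : Space d, ∀ Y : C.lattice, Y ≠ 0 → x ∈ C.cell → x + (Y : Space d) ∉ C.cell := by
    refine ae_all_iff.2 fun Y => ?_
    by_cases hY : Y = 0
    · simp [hY]
    have h := C.tiles.aedisjoint (i := (0 : C.lattice)) (j := -Y) (fun h => hY (by simpa using h.symm))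
    have h' : volume (C.cell ∩ (-Y +ᵥ C.cell)) = 0 := by
      simpa [Function.onFun, AEDisjoint] using h
    filter_upwards [measure_eq_zero_iff_ae_notMem.1 h'] with x hx _ hxc hxY
    refine hx ⟨hxc, x + (Y : Space d), hxY, ?_⟩
    change -(Y : Space d) + (x + Y) = x
    abel
  have hnull : NullMeasurableSet C.cell volume := C.tiles.nullMeasurableSet
  rw [EventuallyEq, ae_restrict_iff'₀ hnull]
  filter_upwards [hdisj] with x hx hxc
  unfold periodize
  rw [tsum_eq_single (0 : C.lattice) fun Y hY => Set.indicator_of_notMem (hx Y hY hxc) f]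
  simp [hxc]

end Extension

/-! ### Orthogonality of divergence-free fields and gradients -/

section Mollification

variable {d : ℕ} {C : UnitCell d}

/-- The convolution of `f` with the test function `ρ`. -/
noncomputable def mollify (f ρ : Space d → ℝ) (x : Space d) : ℝ := ∫ t, f t * ρ (x - t)

theorem mollify_eq_convolution (f ρ : Space d → ℝ) :
    mollify f ρ = convolution f ρ (ContinuousLinearMap.lsmul ℝ ℝ) volume := by
  ext x
  simp [mollify, convolution_def]

variable {f ρ : Space d → ℝ}

theorem contDiff_mollify (hf : LocallyIntegrable f volume) (hρ : ContDiff ℝ ∞ ρ)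
    (hc : HasCompactSupport ρ) : ContDiff ℝ ∞ (mollify f ρ) := by
  rw [mollify_eq_convolution]
  exact hc.contDiff_convolution_right _ hf hρ

theorem pderiv_mollify (hf : LocallyIntegrable f volume) (hρ : ContDiff ℝ ∞ ρ)
    (hc : HasCompactSupport ρ) (j : Fin d) :
    pderiv j (mollify f ρ) = mollify f (pderiv j ρ) := by
  ext x
  rw [mollify_eq_convolution, mollify_eq_convolution]
  unfold pderiv
  rw [(hc.hasFDerivAt_convolution_right _ hf (hρ.of_le (by simp)) x).fderiv,
    convolution_precompR_apply _ hf (hc.fderiv (𝕜 := ℝ)) (hρ.continuous_fderiv (by simp))]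

theorem IsPer.mollify (hf : IsPer C f) (ρ : Space d → ℝ) : IsPer C (mollify f ρ) := by
  intro Y hY x
  unfold PeriodicElasticity.mollify
  rw [← integral_add_right_eq_self _ Y]
  simp only [hf Y hY, add_sub_add_right_eq_sub]

theorem mollify_comm (f ρ : Space d → ℝ) (x : Space d) :
    mollify f ρ x = ∫ h, ρ h * f (x - h) := by
  unfold mollify
  rw [← integral_sub_left_eq_self _ volume x]
  simp [mul_comm]

/-- The divergence of the mollified field at `x` is, up to sign, the distributional divergence
tested against `t ↦ ρ (x - t)`. -/
theorem sum_pderiv_mollify_eq_zero {S : Fin d → Space d → ℝ}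
    (hS : ∀ j, LocallyIntegrable (S j) volume)
    (hdiv : ∀ φ : Space d → ℝ, ContDiff ℝ ∞ φ → HasCompactSupport φ →
      ∑ j, ∫ x, S j x * pderiv j φ x = 0)
    (hρ : ContDiff ℝ ∞ ρ) (hc : HasCompactSupport ρ) (x : Space d) :
    ∑ j, pderiv j (mollify (S j) ρ) x = 0 := by
  have h1 : ContDiff ℝ ∞ fun t => ρ (x - t) := hρ.comp (contDiff_const.sub contDiff_id)
  have h2 : HasCompactSupport fun t => ρ (x - t) := hc.comp_homeomorph (Homeomorph.subLeft x)
  have h3 : ∀ j t, pderiv j (fun t => ρ (x - t)) t = -pderiv j ρ (x - t) := by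
    intro j t
    have hd : HasFDerivAt (fun t : Space d => x - t) (-ContinuousLinearMap.id ℝ (Space d)) t := by
      simpa using (hasFDerivAt_id t).const_sub x
    have := ((hρ.differentiable (by simp) (x - t)).hasFDerivAt.comp t hd).fderiv
    unfold pderiv
    change fderiv ℝ (ρ ∘ fun t => x - t) t _ = _
    rw [this]
    simp
  have h := hdiv _ h1 h2
  simp only [h3, mul_neg, integral_neg, Finset.sum_neg_distrib, neg_eq_zero] at h
  simp only [pderiv_mollify (hS _) hρ hc]
  exact h

/-- Correlations of square-integrable functions are continuous. -/
theorem continuous_correlation {g T : Space d → ℝ} (hg : MemLp g 2 volume)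
    (hT : MemLp T 2 volume) : Continuous fun h => ∫ x, g x * T (x - h) := by
  -- The correlation is the scalar product of `g` with a translate of `T`, and translations act
  -- continuously on `L^p` for finite `p`.
  have hp : Fact ((2 : ℝ≥0∞) ≠ ⊤) := ⟨by simp⟩
  have key : ∀ h : Space d, ∫ x, g x * T (x - h) =
      inner ℝ (DomAddAct.mk (-h) +ᵥ hT.toLp T) (hg.toLp g) := by
    intro h
    rw [L2.inner_def]
    refine integral_congr_ae ?_
    rw [DomAddAct.mk_vadd_toLp]
    filter_upwards [hg.coeFn_toLp, (hT.comp_measurePreserving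
      (measurePreserving_vadd (-h) volume)).coeFn_toLp] with x hx hx'
    rw [hx]
    refine Eq.trans ?_ (congrArg (fun y : ℝ => inner ℝ y (g x)) hx'.symm)
    simp only [vadd_eq_add, Function.comp_apply, neg_add_eq_sub]
    exact mul_comm _ _ |>.trans (by simp [mul_comm])
  simp only [key]
  have hc : Continuous fun h : Space d => DomAddAct.mk (-h) :=
    (DomAddAct.continuous_mk).comp continuous_neg
  exact (hc.vadd continuous_const).inner continuous_const

/-- Fubini applies since `2 * |g * T| ≤ g ^ 2 + T ^ 2`, and each square is jointly integrable
against `|ρ|`. -/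
theorem integral_mul_correlation {g T : Space d → ℝ} (hg : MemLp g 2 volume)
    (hT : MemLp T 2 volume) (hρ : Continuous ρ) (hc : HasCompactSupport ρ) :
    ∫ h, ρ h * ∫ x, g x * T (x - h) = ∫ x, g x * ∫ h, ρ h * T (x - h) := by
  have hρi : Integrable ρ volume := hρ.integrable_of_hasCompactSupport hc
  have hint : Integrable (fun p : Space d × Space d => g p.1 * (ρ p.2 * T (p.1 - p.2)))
      (volume.prod volume) := by
    have h1 : Integrable (fun p : Space d × Space d => g p.1 ^ 2 * |ρ p.2|) (volume.prod volume) :=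
      hg.integrable_sq.mul_prod hρi.abs
    have h2 : Integrable (fun p : Space d × Space d => |ρ p.2| * T (p.1 - p.2) ^ 2)
        (volume.prod volume) :=
      hρi.abs.convolution_integrand (ContinuousLinearMap.mul ℝ ℝ) hT.integrable_sq
    have hm : AEStronglyMeasurable (fun p : Space d × Space d => ρ p.2 * T (p.1 - p.2))
        (volume.prod volume) :=
      hρi.1.convolution_integrand (ContinuousLinearMap.mul ℝ ℝ) hT.1
    refine (h1.add h2).mono' (hg.1.comp_fst.mul hm) (Eventually.of_forall fun p => ?_)
    simp only [Real.norm_eq_abs, abs_mul, Pi.add_apply]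
    have h3 := two_mul_le_add_sq (|g p.1|) (|T (p.1 - p.2)|)
    rw [sq_abs, sq_abs] at h3
    have h4 : 0 ≤ |g p.1| * |T (p.1 - p.2)| := by positivity
    have h5 : 0 ≤ |ρ p.2| := abs_nonneg _
    nlinarith
  simp only [← integral_const_mul]
  rw [integral_integral_swap (f := fun x h => g x * (ρ h * T (x - h))) hint]
  refine integral_congr_ae (Eventually.of_forall fun h => ?_)
  exact integral_congr_ae (Eventually.of_forall fun x => by ring)

/-- Periodic divergence-free fields are orthogonal to gradients of periodic functions. -/
theorem sum_setIntegral_mul_eq_zero {S G : Fin d → Space d → ℝ} {w : Space d → ℝ}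
    (hS : ∀ j, IsPer C (S j)) (hS2 : ∀ j, MemLp (S j) 2 C.meas)
    (hG : ∀ j, IsPer C (G j)) (hG2 : ∀ j, MemLp (G j) 2 C.meas)
    (hw : IsPer C w) (hw2 : MemLp w 2 C.meas)
    (hdiv : ∀ φ : Space d → ℝ, ContDiff ℝ ∞ φ → HasCompactSupport φ →
      ∑ j, ∫ x, S j x * pderiv j φ x = 0)
    (hgrad : ∀ j, HasWeakPDeriv j w (G j)) :
    ∑ j, ∫ x in C.cell, S j x * G j x = 0 := by
  obtain ⟨χ, hχ, hχc, h1⟩ := exists_cutoff C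
  have hSl : ∀ j, LocallyIntegrable (S j) volume := fun j =>
    (hS j).locallyIntegrable ((hS2 j).integrable (by simp))
  have hwl : LocallyIntegrable w volume := hw.locallyIntegrable (hw2.integrable (by simp))
  -- orthogonality to the mollified fields
  have hmol : ∀ ρ : Space d → ℝ, ContDiff ℝ ∞ ρ → HasCompactSupport ρ →
      ∑ j, ∫ x, G j x * χ x * mollify (S j) ρ x = 0 := by
    intro ρ hρ hc
    have hsm : ∀ j, SmoothPer C (mollify (S j) ρ) := fun j =>
      ⟨contDiff_mollify (hSl j) hρ hc, (hS j).mollify ρ⟩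
    -- The weak gradient is tested against `χ` times the smooth field. The term with the derivative
    -- of `χ` vanishes by periodicity, and the sum over `j` of the other terms contains the zero
    -- divergence.
    have e1 : ∀ j, ∫ x, G j x * χ x * mollify (S j) ρ x =
        -∫ x, w x * (χ x * pderiv j (mollify (S j) ρ) x) := by
      intro j
      have h := hgrad j (fun x => χ x * mollify (S j) ρ x) (hχ.mul (hsm j).smooth) hχc.mul_right
      simp only [pderiv_mul hχ (hsm j).smooth, mul_add, ← mul_assoc] at h
      rw [integral_add] at h
      · have h2 : ∫ x, w x * pderiv j χ x * mollify (S j) ρ x = 0 := by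
          rw [← integral_mul_pderiv_cutoff (f := fun x => w x * mollify (S j) ρ x)
            (hw.comp₂ (hsm j).per (· * ·)) ?_ hχ hχc h1 j]
          · exact integral_congr_ae (Eventually.of_forall fun x => by ring)
          · exact (hsm j).memLp_two.integrable_mul hw2 |>.congr
              (Eventually.of_forall fun x => mul_comm _ _)
        rw [h2, add_zero] at h
        simp only [← mul_assoc]
        linarith
      · simpa only [mul_assoc, Pi.mul_apply] using LocallyIntegrable.integrable_mul_of_hasCompactSupport hwl
          (hχ.continuous.mul (continuous_pderiv (hsm j).smooth j)) hχc.mul_right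
      · simpa only [mul_assoc, Pi.mul_apply] using LocallyIntegrable.integrable_mul_of_hasCompactSupport hwl
          ((continuous_pderiv hχ j).mul (hsm j).smooth.continuous)
          (hasCompactSupport_pderiv hχc j).mul_right
    simp only [e1, Finset.sum_neg_distrib, neg_eq_zero]
    rw [← integral_finsetSum]
    · rw [← integral_zero (Space d) ℝ]
      refine integral_congr_ae (Eventually.of_forall fun x => ?_)
      simp only [← Finset.mul_sum, sum_pderiv_mollify_eq_zero hSl hdiv hρ hc, mul_zero]
    · intro j _
      exact LocallyIntegrable.integrable_mul_of_hasCompactSupport hwl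
          (hχ.continuous.mul (continuous_pderiv (hsm j).smooth j)) hχc.mul_right
  -- removal of the mollification
  obtain ⟨R, hR⟩ := hχc.isCompact.isBounded.exists_norm_le
  -- For `‖h‖ < 1` and `x` in the support of `χ`, the point `x - h` stays in `B`. Truncating to `B`
  -- makes the stress globally `L²` without altering the correlations that matter.
  set B : Set (Space d) := Metric.closedBall 0 (R + 1) with hB
  set g : Fin d → Space d → ℝ := fun j x => G j x * χ x with hg
  set T : Fin d → Space d → ℝ := fun j => B.indicator (S j) with hT
  have hg2 : ∀ j, MemLp (g j) 2 volume := by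
    intro j
    have hm : AEStronglyMeasurable (g j) volume :=
      ((hG j).aestronglyMeasurable (hG2 j).1).mul hχ.continuous.aestronglyMeasurable
    rw [memLp_two_iff_integrable_sq hm]
    have := LocallyIntegrable.integrable_mul_of_hasCompactSupport
      (((hG j).comp (· ^ 2)).locallyIntegrable (hG2 j).integrable_sq)
      (hχ.continuous.mul hχ.continuous) hχc.mul_right
    refine this.congr (Eventually.of_forall fun x => ?_)
    simp only [hg, Pi.mul_apply]
    ring
  have hT2 : ∀ j, MemLp (T j) 2 volume := fun j =>
    (memLp_indicator_iff_restrict measurableSet_closedBall).2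
      (((hS j).memL2Per (hS2 j)).1 B (isCompact_closedBall _ _))
  set F : Space d → ℝ := fun h => ∑ j, ∫ x, g j x * T j (x - h) with hF
  have hFc : Continuous F := continuous_finsetSum _ fun j _ => continuous_correlation (hg2 j) (hT2 j)
  have hg0 : ∀ j x, g j x ≠ 0 → ‖x‖ ≤ R := fun j x hx =>
    hR x (subset_tsupport _ fun h0 => hx (by simp [hg, h0]))
  -- No approximate identity is needed: `F` integrates to zero against every test function supported
  -- in the unit ball, so the continuous function `F` vanishes there. Its value at 0 is the desired
  -- sum.
  have hF0 : ∀ᵐ h : Space d, h ∈ Metric.ball (0 : Space d) 1 → F h = 0 := by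
    refine Metric.isOpen_ball.ae_eq_zero_of_integral_contDiff_smul_eq_zero
      (hFc.continuousOn.locallyIntegrableOn measurableSet_ball) ?_
    intro ρ hρ hc hsupp
    have e2 : ∀ j, ∫ h, ρ h * ∫ x, g j x * T j (x - h) = ∫ x, g j x * mollify (S j) ρ x := by
      intro j
      rw [integral_mul_correlation (hg2 j) (hT2 j) hρ.continuous hc]
      refine integral_congr_ae (Eventually.of_forall fun x => ?_)
      by_cases hx : g j x = 0
      · simp [hx]
      simp only [mollify_comm]
      congr 1
      refine integral_congr_ae (Eventually.of_forall fun h => ?_)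
      by_cases hh : ρ h = 0
      · simp [hh]
      have hh1 : ‖h‖ < 1 := by simpa using hsupp (subset_tsupport _ hh)
      have hmem : x - h ∈ B := by
        simp only [hB, mem_closedBall_zero_iff]
        have := norm_sub_le x h
        have := hg0 j x hx
        linarith
      simp [hT, hmem]
    simp only [hF, smul_eq_mul, Finset.mul_sum]
    rw [integral_finsetSum]
    · simp only [e2]
      exact hmol ρ hρ hc
    · intro j _
      exact ((hρ.continuous.mul (continuous_correlation (hg2 j) (hT2 j))).integrable_of_hasCompactSupport
        hc.mul_right)
  have hF00 : F 0 = 0 := by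
    have := Measure.eqOn_open_of_ae_eq (μ := (volume : Measure (Space d))) (f := F) (g := fun _ => 0)
      (U := Metric.ball 0 1) ((ae_restrict_iff' measurableSet_ball).2 hF0) Metric.isOpen_ball
      hFc.continuousOn continuousOn_const
    exact this (Metric.mem_ball_self one_pos)
  rw [← hF00]
  simp only [hF, sub_zero]
  refine Finset.sum_congr rfl fun j _ => ?_
  rw [← integral_mul_cutoff (f := fun x => S j x * G j x) ((hS j).comp₂ (hG j) (· * ·))
    ((hS2 j).integrable_mul (hG2 j)) hχ hχc h1]
  refine integral_congr_ae (Eventually.of_forall fun x => ?_)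
  by_cases hx : g j x = 0
  · simp only [hx, zero_mul]
    rw [mul_assoc, show G j x * χ x = 0 from hx, mul_zero]
  have hmem : x ∈ B := by
    simp only [hB, mem_closedBall_zero_iff]
    have := hg0 j x hx
    linarith
  simp only [hT, hg, Set.indicator_of_mem hmem]
  ring

end Mollification

end PeriodicElasticity

namespace PeriodicElasticity

open MeasureTheory Filter Topology
open scoped ContDiff ENNReal

/-! ### Two Hilbert space tools -/

section Hilbert

theorem cauchySeq_of_norm_sub_le_mul {X Y : Type*} [SeminormedAddCommGroup X]
    [SeminormedAddCommGroup Y] {u : ℕ → X} {v : ℕ → Y} (K : ℝ)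
    (h : ∀ m n, ‖v m - v n‖ ≤ K * ‖u m - u n‖) (hu : CauchySeq u) : CauchySeq v := by
  simp only [← dist_eq_norm] at h
  rw [cauchySeq_iff_tendsto_dist_atTop_0] at hu ⊢
  refine squeeze_zero (fun _ => dist_nonneg) (fun p => h p.1 p.2) ?_
  simpa using hu.const_mul K

/-- The double orthogonal complement of a subspace consists of limits of its elements. -/
theorem exists_seq_tendsto_of_orthogonal {X V : Type*} [MeasurableSpace X] {μ : Measure X}
    [NormedAddCommGroup V] [InnerProductSpace ℝ V] [CompleteSpace V] {K : Set (Lp V 2 μ)}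
    (h0 : 0 ∈ K) (hadd : ∀ a ∈ K, ∀ b ∈ K, a + b ∈ K) (hsmul : ∀ (c : ℝ), ∀ a ∈ K, c • a ∈ K)
    {e : Lp V 2 μ} (h : ∀ s : Lp V 2 μ, (∀ k ∈ K, inner ℝ s k = 0) → inner ℝ s e = 0) :
    ∃ u : ℕ → Lp V 2 μ, (∀ n, u n ∈ K) ∧ Tendsto u atTop (𝓝 e) := by
  let M : Submodule ℝ (Lp V 2 μ) :=
    { carrier := K
      zero_mem' := h0
      add_mem' := fun {a b} ha hb => hadd a ha b hb
      smul_mem' := hsmul }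
  have he : e ∈ M.topologicalClosure := by
    rw [← Submodule.orthogonal_orthogonal_eq_closure, Submodule.mem_orthogonal]
    exact fun s hs => h s fun k hk => Submodule.inner_left_of_mem_orthogonal (K := M) hk hs
  exact mem_closure_iff_seq_limit.1 he

end Hilbert

/-! ### Symmetric tensor fields, smooth strains and their orthogonal fields -/

section Fields

variable {d : ℕ}

/-- The components of a symmetric tensor as continuous linear forms. -/
noncomputable def compL (i j : Fin d) : SymTensor d →L[ℝ] ℝ :=
  (EuclideanSpace.proj (i, j) : EuclideanSpace ℝ (Fin d × Fin d) →L[ℝ] ℝ).comp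
    (symTensors d).subtypeL

theorem compL_apply (i j : Fin d) (A : SymTensor d) : compL i j A = A.comp i j := rfl

theorem SymTensor.comp_symm (A : SymTensor d) (i j : Fin d) : A.comp i j = A.comp j i := A.2 i j

theorem SymTensor.inner_eq (A B : SymTensor d) :
    inner ℝ A B = ∑ i, ∑ j, A.comp i j * B.comp i j := by
  rw [Submodule.coe_inner, PiLp.inner_apply, Fintype.sum_prod_type]
  refine Finset.sum_congr rfl fun i _ => Finset.sum_congr rfl fun j _ => ?_
  simp [SymTensor.comp, mul_comm]

/-- Symmetrisation of a square array. -/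
noncomputable def symPart : (Fin d → Fin d → ℝ) →ₗ[ℝ] SymTensor d where
  toFun m := ⟨WithLp.toLp 2 fun p => (1 / 2) * (m p.1 p.2 + m p.2 p.1), fun i j => by
    simp [add_comm]⟩
  map_add' m m' := by
    ext p
    simp
    ring
  map_smul' c m := by
    ext p
    simp
    ring

theorem symPart_comp (m : Fin d → Fin d → ℝ) (i j : Fin d) :
    (symPart m).comp i j = (1 / 2) * (m i j + m j i) := rfl

variable {C : UnitCell d}

theorem exists_symField {f : Fin d → Fin d → Space d → ℝ} (hf : ∀ i j, MemLp (f i j) 2 C.meas) :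
    ∃ e : TField C, ∀ᵐ x ∂C.meas, ∀ i j, (e x).comp i j = (1 / 2) * (f i j x + f j i x) := by
  have h1 : MemLp (fun x i j => f i j x) 2 C.meas :=
    MemLp.of_eval fun i => MemLp.of_eval fun j => hf i j
  have h2 := (LinearMap.toContinuousLinearMap (symPart (d := d))).comp_memLp' h1
  refine ⟨h2.toLp _, ?_⟩
  filter_upwards [h2.coeFn_toLp] with x hx i j
  rw [hx]
  exact symPart_comp _ i j

theorem memLp_comp (τ : TField C) (i j : Fin d) :
    MemLp (fun x => (τ x).comp i j) 2 C.meas :=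
  (compL i j).comp_memLp τ

theorem inner_eq_sum_integral {τ e : TField C} {T E : Fin d → Fin d → Space d → ℝ}
    (hT2 : ∀ i j, MemLp (T i j) 2 C.meas) (hE2 : ∀ i j, MemLp (E i j) 2 C.meas)
    (hT : ∀ᵐ x ∂C.meas, ∀ i j, (τ x).comp i j = T i j x)
    (hE : ∀ᵐ x ∂C.meas, ∀ i j, (e x).comp i j = E i j x) :
    inner ℝ τ e = ∑ i, ∑ j, ∫ x in C.cell, T i j x * E i j x := by
  have hI : ∀ i j, Integrable (fun x => T i j x * E i j x) C.meas := fun i j =>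
    (hT2 i j).integrable_mul (hE2 i j)
  simp only [← integral_finsetSum _ fun j _ => hI _ j]
  rw [← integral_finsetSum _ fun i _ => integrable_finsetSum _ fun j _ => hI i j, L2.inner_def]
  refine integral_congr_ae ?_
  filter_upwards [hT, hE] with x h1 h2
  rw [SymTensor.inner_eq]
  simp only [h1, h2]

/-- A symmetric tensor does not see the antisymmetric part of `G`, so a strain may be replaced by
the full gradient. -/
theorem inner_symGrad {τ e : TField C} {T G : Fin d → Fin d → Space d → ℝ}
    (hT2 : ∀ i j, MemLp (T i j) 2 C.meas) (hG2 : ∀ i j, MemLp (G i j) 2 C.meas)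
    (hT : ∀ᵐ x ∂C.meas, ∀ i j, (τ x).comp i j = T i j x)
    (hE : ∀ᵐ x ∂C.meas, ∀ i j, (e x).comp i j = (1 / 2) * (G i j x + G j i x)) :
    inner ℝ τ e = ∑ i, ∑ j, ∫ x in C.cell, T i j x * G i j x := by
  have hI : ∀ i j k l, Integrable (fun x => T i j x * G k l x) C.meas := fun i j k l =>
    (hT2 i j).integrable_mul (hG2 k l)
  have h1 := inner_eq_sum_integral (E := fun i j x => (1 / 2) * (G i j x + G j i x)) hT2
    (fun i j => ((hG2 i j).add (hG2 j i)).const_mul _) hT hE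
  have h2 : ∀ i j, ∫ x in C.cell, T i j x * ((1 / 2) * (G i j x + G j i x)) =
      (1 / 2) * (∫ x in C.cell, T i j x * G i j x) +
      (1 / 2) * ∫ x in C.cell, T j i x * G j i x := by
    intro i j
    rw [← integral_const_mul, ← integral_const_mul, ← integral_add ((hI i j i j).const_mul _)
      ((hI j i j i).const_mul _)]
    refine integral_congr_ae ?_
    filter_upwards [hT] with x hx
    rw [← hx i j, ← hx j i, (τ x).comp_symm j i]
    ring
  rw [h1]
  simp only [h2, Finset.sum_add_distrib, ← Finset.mul_sum]
  rw [Finset.sum_comm (f := fun i j => ∫ x in C.cell, T j i x * G j i x)]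
  ring

theorem SmoothPer.const_mul {f : Space d → ℝ} (hf : SmoothPer C f) (c : ℝ) :
    SmoothPer C (fun x => c * f x) :=
  ⟨contDiff_const.mul hf.smooth, hf.per.comp (c * ·)⟩

theorem SmoothPer.add {f g : Space d → ℝ} (hf : SmoothPer C f) (hg : SmoothPer C g) :
    SmoothPer C (fun x => f x + g x) :=
  ⟨hf.smooth.add hg.smooth, hf.per.comp₂ hg.per (· + ·)⟩

theorem smoothPer_const (C : UnitCell d) (c : ℝ) : SmoothPer C (fun _ => c) :=
  ⟨contDiff_const, fun _ _ _ => rfl⟩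

theorem pderiv_const (c : ℝ) (j : Fin d) (x : Space d) : pderiv j (fun _ => c) x = 0 := by
  simp [pderiv]

/-- `e` is the symmetrised gradient of the smooth field `w`, almost everywhere on the cell. -/
def IsSymGrad (C : UnitCell d) (w : Fin d → Space d → ℝ) (e : TField C) : Prop :=
  ∀ᵐ x ∂C.meas, ∀ i j, (e x).comp i j = (1 / 2) * (pderiv j (w i) x + pderiv i (w j) x)

/-- Symmetrised gradients of smooth periodic displacements. -/
noncomputable def smoothStrains (C : UnitCell d) : Submodule ℝ (TField C) where
  carrier := {e | ∃ w : Fin d → Space d → ℝ, (∀ i, SmoothPer C (w i)) ∧ IsSymGrad C w e}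
  zero_mem' := by
    refine ⟨fun _ _ => 0, fun _ => smoothPer_const C 0, ?_⟩
    filter_upwards [Lp.coeFn_zero (SymTensor d) 2 C.meas] with x hx i j
    rw [hx]
    simp [pderiv_const, ← compL_apply]
  add_mem' := by
    rintro e e' ⟨w, hw, he⟩ ⟨w', hw', he'⟩
    refine ⟨fun i x => w i x + w' i x, fun i => (hw i).add (hw' i), ?_⟩
    filter_upwards [Lp.coeFn_add e e', he, he'] with x hx h1 h2 i j
    have hp : ∀ i j, pderiv j (fun x => w i x + w' i x) x =
        pderiv j (w i) x + pderiv j (w' i) x := fun i j => by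
      unfold pderiv
      rw [fderiv_fun_add ((hw i).smooth.differentiable (by simp) x)
        ((hw' i).smooth.differentiable (by simp) x)]
      simp
    rw [hx, ← compL_apply, Pi.add_apply, map_add, compL_apply, compL_apply, h1, h2, hp, hp]
    ring
  smul_mem' := by
    rintro c e ⟨w, hw, he⟩
    refine ⟨fun i x => c * w i x, fun i => (hw i).const_mul c, ?_⟩
    filter_upwards [Lp.coeFn_smul c e, he] with x hx h1 i j
    have hp : ∀ i j, pderiv j (fun x => c * w i x) x = c * pderiv j (w i) x := fun i j => by
      unfold pderiv
      rw [fderiv_const_mul ((hw i).smooth.differentiable (by simp) x)]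
      simp
    rw [hx, ← compL_apply, Pi.smul_apply, map_smul, compL_apply, h1, hp, hp, smul_eq_mul]
    ring

/-- Subtracting constants does not change the strain; the normalisation is what the Poincaré
inequality requires. -/
theorem exists_potential_mean_zero {e : TField C} (he : e ∈ smoothStrains C) :
    ∃ w : Fin d → Space d → ℝ, (∀ i, SmoothPer C (w i)) ∧ IsSymGrad C w e ∧
      ∀ i, ∫ x in C.cell, w i x = 0 := by
  obtain ⟨w, hw, he⟩ := he
  have hm : volume.real C.cell ≠ 0 :=
    (ENNReal.toReal_pos C.volume_cell_ne_zero C.volume_cell_ne_top).ne'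
  set c : Fin d → ℝ := fun i => (∫ x in C.cell, w i x) / volume.real C.cell
  refine ⟨fun i x => w i x - c i, fun i => (hw i).sub (smoothPer_const C _), ?_, fun i => ?_⟩
  · filter_upwards [he] with x hx i j
    rw [hx, pderiv_sub (hw i).smooth contDiff_const, pderiv_sub (hw j).smooth contDiff_const,
      pderiv_const, pderiv_const, sub_zero, sub_zero]
  · rw [integral_sub (hw i).integrable (integrable_const _)]
    simp [c]
    field_simp
    simp

theorem integral_pderiv {φ : Space d → ℝ} (hφ : ContDiff ℝ ∞ φ) (hc : HasCompactSupport φ)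
    (j : Fin d) : ∫ x, pderiv j φ x = 0 := by
  have := integral_mul_pderiv (f := fun _ => 1) contDiff_const hφ hc j
  simpa [pderiv_const] using this

/-- Orthogonality to the strain of a periodized test function unfolds to the divergence equation on
the whole space. The mean of `τ` is then split off as the uniform part. -/
theorem mem_admStresses_of_orthogonal {τ : TField C}
    (h : ∀ e ∈ smoothStrains C, inner ℝ τ e = 0) : τ ∈ admStresses C := by
  choose T hTp hTe using fun i j => exists_periodic_extension C fun x => (τ x).comp i j
  have hT2 : ∀ i j, MemLp (T i j) 2 C.meas := fun i j => (memLp_comp τ i j).ae_eq (hTe i j).symm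
  have hT : ∀ᵐ x ∂C.meas, ∀ i j, (τ x).comp i j = T i j x := by
    refine ae_all_iff.2 fun i => ae_all_iff.2 fun j => ?_
    filter_upwards [hTe i j] with x hx using hx.symm
  have hTi : ∀ i j, Integrable (T i j) C.meas := fun i j => (hT2 i j).integrable (by simp)
  have hdiv : ∀ (i : Fin d) (φ : Space d → ℝ), ContDiff ℝ ∞ φ → HasCompactSupport φ →
      ∑ j, ∫ x, T i j x * pderiv j φ x = 0 := by
    intro i φ hφ hc
    -- Only the `i`-th component of the displacement is nonzero, which isolates the `i`-th row of
    -- the stress.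
    set w : Fin d → Space d → ℝ := fun k => if k = i then periodize C φ else fun _ => 0 with hw
    have hws : ∀ k, SmoothPer C (w k) := by
      intro k
      by_cases hk : k = i
      · simpa [hw, hk] using smoothPer_periodize hφ hc
      · simpa [hw, hk] using smoothPer_const C 0
    have hG2 : ∀ k l, MemLp (pderiv l (w k)) 2 C.meas := fun k l =>
      ((hws k).partialDeriv l).memLp_two
    obtain ⟨e, he⟩ := exists_symField (f := fun k l => pderiv l (w k)) hG2
    have h0 := h e ⟨w, hws, he⟩
    rw [inner_symGrad (G := fun k l => pderiv l (w k)) hT2 hG2 hT he,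
      Finset.sum_eq_single i] at h0
    · rw [← h0]
      refine Finset.sum_congr rfl fun j _ => ?_
      rw [integral_mul_eq_setIntegral_periodize (hTp i j) (hTi i j) (continuous_pderiv hφ j)
        (hasCompactSupport_pderiv hc j), ← pderiv_periodize hφ hc]
      simp [hw]
    · intro k _ hk
      simp [hw, hk, pderiv_const]
    · simp
  set u : SymTensor d := ⨍ x in C.cell, τ x with hu
  have hτi : Integrable τ C.meas := (Lp.memLp τ).integrable (by simp)
  have hsub : ⇑(τ - Lp.const 2 C.meas u) =ᵐ[C.meas] fun x => τ x - u := by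
    filter_upwards [Lp.coeFn_sub τ (Lp.const 2 C.meas u), Lp.coeFn_const (p := 2) (μ := C.meas) u]
      with x h1 h2
    rw [h1, Pi.sub_apply, h2]
    rfl
  refine ⟨Lp.const 2 C.meas u, ⟨u, rfl⟩, τ - Lp.const 2 C.meas u, ⟨?_, ?_⟩, by abel⟩
  · refine ⟨fun i j x => T i j x - u.comp i j, fun i j => ?_, ?_, fun i φ hφ hc => ?_⟩
    · exact ((hTp i j).comp fun a => a - u.comp i j).memL2Per ((hT2 i j).sub (memLp_const _))
    · filter_upwards [hsub, hT] with x h1 h2 i j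
      rw [h1, ← compL_apply, map_sub, compL_apply, compL_apply, h2]
    · rw [← hdiv i φ hφ hc]
      refine Finset.sum_congr rfl fun j _ => ?_
      simp only [sub_mul]
      rw [integral_sub, integral_const_mul, integral_pderiv hφ hc, mul_zero, sub_zero]
      · exact LocallyIntegrable.integrable_mul_of_hasCompactSupport
          ((hTp i j).locallyIntegrable (hTi i j)) (continuous_pderiv hφ j)
          (hasCompactSupport_pderiv hc j)
      · exact ((continuous_pderiv hφ j).integrable_of_hasCompactSupport
          (hasCompactSupport_pderiv hc j)).const_mul _
  · have hm : volume.real C.cell ≠ 0 :=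
      (ENNReal.toReal_pos C.volume_cell_ne_zero C.volume_cell_ne_top).ne'
    rw [average_congr hsub, average_eq, integral_sub hτi (integrable_const _), integral_const,
      hu, average_eq]
    simp [smul_smul, hm]

/-- After passage to exactly periodic representatives this is the orthogonality of divergence-free
fields and gradients, row by row. The uniform part is also divergence-free, since derivatives of
test functions integrate to zero. -/
theorem inner_admStresses_compatFields {s e : TField C} (hs : s ∈ admStresses C)
    (he : e ∈ compatFields C) : inner ℝ s e = 0 := by
  obtain ⟨_, ⟨u, rfl⟩, s₀, ⟨⟨S, hS, hSe, hdiv⟩, -⟩, rfl⟩ := hs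
  obtain ⟨w, G, ⟨hw, hG⟩, hGe⟩ := he
  choose S' hSS hSp hS2 using fun i j => (hS i j).exists_isPer
  choose w' hww hwp hw2 using fun i => (hw i).exists_isPer
  choose G' hGG hGp hG2 using fun i j => (hG i j).1.exists_isPer
  have hT2 : ∀ i j, MemLp (fun x => S' i j x + u.comp i j) 2 C.meas := fun i j =>
    (hS2 i j).add (memLp_const _)
  have hallS : ∀ᵐ x ∂C.meas, ∀ i j, S i j x = S' i j x :=
    ae_all_iff.2 fun i => ae_all_iff.2 fun j => ae_restrict_of_ae (hSS i j)
  have hallG : ∀ᵐ x ∂C.meas, ∀ i j, G i j x = G' i j x :=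
    ae_all_iff.2 fun i => ae_all_iff.2 fun j => ae_restrict_of_ae (hGG i j)
  rw [inner_symGrad (T := fun i j x => S' i j x + u.comp i j) (G := G') hT2 hG2]
  · refine Finset.sum_eq_zero fun i _ => ?_
    refine sum_setIntegral_mul_eq_zero (w := w' i)
      (fun j => (hSp i j).comp fun a => a + u.comp i j) (hT2 i) (hGp i) (hG2 i) (hwp i) (hw2 i)
      (fun φ hφ hc => ?_) (fun j φ hφ hc => ?_)
    · rw [← hdiv i φ hφ hc]
      refine Finset.sum_congr rfl fun j _ => ?_
      simp only [add_mul]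
      rw [integral_add, integral_const_mul, integral_pderiv hφ hc, mul_zero, add_zero]
      · refine integral_congr_ae ?_
        filter_upwards [hSS i j] with x hx
        rw [hx]
      · exact LocallyIntegrable.integrable_mul_of_hasCompactSupport
          ((hSp i j).locallyIntegrable ((hS2 i j).integrable (by simp))) (continuous_pderiv hφ j)
          (hasCompactSupport_pderiv hc j)
      · exact ((continuous_pderiv hφ j).integrable_of_hasCompactSupport
          (hasCompactSupport_pderiv hc j)).const_mul _
    · have h := (hG i j).2 φ hφ hc
      have e1 : ∫ x, w i x * pderiv j φ x = ∫ x, w' i x * pderiv j φ x := by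
        refine integral_congr_ae ?_
        filter_upwards [hww i] with x hx
        rw [hx]
      have e2 : ∫ x, G i j x * φ x = ∫ x, G' i j x * φ x := by
        refine integral_congr_ae ?_
        filter_upwards [hGG i j] with x hx
        rw [hx]
      rw [← e1, ← e2, h]
  · filter_upwards [Lp.coeFn_add (Lp.const 2 C.meas u) s₀, Lp.coeFn_const (p := 2) (μ := C.meas) u,
      hSe, hallS] with x h1 h2 h3 h4 i j
    rw [h1, Pi.add_apply, ← compL_apply, map_add, compL_apply, compL_apply, h2, h3, h4, add_comm]
    rfl
  · filter_upwards [hGe, hallG] with x h1 h2 i j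
    rw [h1, h2, h2]

end Fields

/-! ### Closedness of the compatible strains and the duality -/

section Closure

variable {d : ℕ} {C : UnitCell d}

theorem norm_toLp_sq {f : Space d → ℝ} (hf : MemLp f 2 C.meas) :
    ‖hf.toLp f‖ ^ 2 = ∫ x in C.cell, f x ^ 2 := by
  rw [← real_inner_self_eq_norm_sq, L2.inner_def]
  refine integral_congr_ae ?_
  filter_upwards [hf.coeFn_toLp] with x hx
  rw [hx]
  simp [pow_two]

/-- A smooth mean-free potential is controlled by its strain. -/
theorem exists_potential_bound (C : UnitCell d) : ∃ K : ℝ, 0 ≤ K ∧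
    ∀ (w : Fin d → Space d → ℝ) (e : TField C), (∀ i, SmoothPer C (w i)) → IsSymGrad C w e →
      (∀ i, ∫ x in C.cell, w i x = 0) →
      (∀ i, ∫ x in C.cell, w i x ^ 2 ≤ (K * ‖e‖) ^ 2) ∧
      ∀ i j, ∫ x in C.cell, pderiv j (w i) x ^ 2 ≤ (K * ‖e‖) ^ 2 := by
  obtain ⟨K, hK0, hK⟩ := poincare C
  -- Korn bounds the squared gradient by `2 * ‖e‖ ^ 2`, and Poincaré bounds the squared potential by
  -- `2 * K * ‖e‖ ^ 2`. Both 2 and `2 * K` are at most `(K + 2) ^ 2`.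
  refine ⟨K + 2, by linarith, fun w e hw he h0 => ?_⟩
  have hG2 : ∀ k l, MemLp (pderiv l (w k)) 2 C.meas := fun k l =>
      ((hw k).partialDeriv l).memLp_two
  have hE2 : ∀ i j, MemLp (fun x => (1 / 2) * (pderiv j (w i) x + pderiv i (w j) x)) 2 C.meas :=
    fun i j => ((hG2 i j).add (hG2 j i)).const_mul _
  have hN := inner_eq_sum_integral (τ := e) (e := e) hE2 hE2 he he
  rw [show inner ℝ e e = ‖e‖ ^ 2 from real_inner_self_eq_norm_sq e] at hN
  have hkorn := korn hw
  simp only [← pow_two] at hN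
  rw [← hN] at hkorn
  have hpos : ∀ i j, 0 ≤ ∫ x in C.cell, pderiv j (w i) x ^ 2 := fun i j =>
    integral_nonneg fun x => sq_nonneg _
  have hrow : ∀ i, ∑ j, ∫ x in C.cell, pderiv j (w i) x ^ 2 ≤ 2 * ‖e‖ ^ 2 := fun i =>
    (Finset.single_le_sum (f := fun i => ∑ j, ∫ x in C.cell, pderiv j (w i) x ^ 2)
      (fun i _ => Finset.sum_nonneg fun j _ => hpos i j) (Finset.mem_univ i)).trans hkorn
  have hn : 0 ≤ ‖e‖ ^ 2 := sq_nonneg _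
  refine ⟨fun i => ?_, fun i j => ?_⟩
  · have h1 := hK (w i) (hw i) (h0 i)
    have h2 := mul_le_mul_of_nonneg_left (hrow i) hK0
    nlinarith [mul_nonneg (sq_nonneg K) hn, mul_nonneg hK0 hn]
  · have h1 := (Finset.single_le_sum (f := fun j => ∫ x in C.cell, pderiv j (w i) x ^ 2)
      (fun j _ => hpos i j) (Finset.mem_univ j)).trans (hrow i)
    nlinarith [mul_nonneg (sq_nonneg K) hn, mul_nonneg hK0 hn]

/-- Test functions pass to the limit along `L²` limits of periodic functions. -/
theorem tendsto_integral_mul {u : ℕ → Space d → ℝ} (hu : ∀ n, SmoothPer C (u n))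
    {f : Lp ℝ 2 C.meas} (hf : Tendsto (fun n => (hu n).memLp_two.toLp (u n)) atTop (𝓝 f))
    {W : Space d → ℝ} (hW : IsPer C W) (hWf : W =ᵐ[C.meas] f) {φ : Space d → ℝ}
    (hφ : Continuous φ) (hc : HasCompactSupport φ) :
    Tendsto (fun n => ∫ x, u n x * φ x) atTop (𝓝 (∫ x, W x * φ x)) := by
  have hp : MemLp (periodize C φ) 2 C.meas :=
    (isPer_periodize C φ).memLp_two (continuous_periodize hφ hc)
  have hW2 : MemLp W 2 C.meas := (Lp.memLp f).ae_eq hWf.symm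
  have e1 : ∀ n, ∫ x, u n x * φ x =
      inner ℝ (hp.toLp _) ((hu n).memLp_two.toLp (u n)) := by
    intro n
    rw [integral_mul_eq_setIntegral_periodize (hu n).per (hu n).integrable hφ hc, L2.inner_def]
    refine integral_congr_ae ?_
    filter_upwards [hp.coeFn_toLp, (hu n).memLp_two.coeFn_toLp] with x h1 h2
    rw [h1, h2]
    simp
  have e2 : ∫ x, W x * φ x = inner ℝ (hp.toLp _) f := by
    rw [integral_mul_eq_setIntegral_periodize hW (hW2.integrable (by simp)) hφ hc, L2.inner_def]
    refine integral_congr_ae ?_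
    filter_upwards [hp.coeFn_toLp, hWf] with x h1 h2
    rw [h1, ← h2]
    simp
  simp only [e1, e2]
  exact tendsto_const_nhds.inner hf

/-- The bound by the strain, applied to differences, makes the mean-free potentials and their
gradients Cauchy in `L²`. Their limits, extended periodically, satisfy the weak derivative relation
because test functions pass to the limit. -/
theorem mem_compatFields_of_tendsto {e : TField C} {s : ℕ → TField C}
    (hs : ∀ n, s n ∈ smoothStrains C) (hlim : Tendsto s atTop (𝓝 e)) : e ∈ compatFields C := by
  choose w hw hws hw0 using fun n => exists_potential_mean_zero (hs n)
  obtain ⟨K, hK0, hK⟩ := exists_potential_bound C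
  have hdiff : ∀ m n, (∀ i, ∫ x in C.cell, (w m i x - w n i x) ^ 2 ≤ (K * ‖s m - s n‖) ^ 2) ∧
      ∀ i j, ∫ x in C.cell, (pderiv j (w m i) x - pderiv j (w n i) x) ^ 2 ≤
        (K * ‖s m - s n‖) ^ 2 := by
    intro m n
    have h := hK (fun i x => w m i x - w n i x) (s m - s n) (fun i => (hw m i).sub (hw n i)) ?_ ?_
    · simpa only [pderiv_sub (hw m _).smooth (hw n _).smooth] using h
    · filter_upwards [Lp.coeFn_sub (s m) (s n), hws m, hws n] with x h1 h2 h3 i j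
      rw [h1, Pi.sub_apply, ← compL_apply, map_sub, compL_apply, compL_apply, h2, h3,
        pderiv_sub (hw m _).smooth (hw n _).smooth, pderiv_sub (hw m _).smooth (hw n _).smooth]
      ring
    · intro i
      rw [integral_sub (hw m i).integrable (hw n i).integrable, hw0, hw0, sub_zero]
  have hcau : CauchySeq s := hlim.cauchySeq
  have hnorm : ∀ {f g : Space d → ℝ} (hf : MemLp f 2 C.meas) (hg : MemLp g 2 C.meas) (r : ℝ),
      0 ≤ r → ∫ x in C.cell, (f x - g x) ^ 2 ≤ r ^ 2 → ‖hf.toLp f - hg.toLp g‖ ≤ r := by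
    intro f g hf hg r hr h
    rw [← MemLp.toLp_sub]
    refine le_of_sq_le_sq ?_ hr
    rw [norm_toLp_sq]
    exact h
  have hr : ∀ m n, 0 ≤ K * ‖s m - s n‖ := fun m n => mul_nonneg hK0 (norm_nonneg (E := TField C) _)
  have hwc : ∀ i, CauchySeq fun n => (hw n i).memLp_two.toLp (w n i) := fun i =>
    cauchySeq_of_norm_sub_le_mul K (fun m n => hnorm _ _ _ (hr m n) ((hdiff m n).1 i)) hcau
  have hgc : ∀ i j, CauchySeq fun n =>
      ((hw n i).partialDeriv j).memLp_two.toLp (pderiv j (w n i)) := fun i j =>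
    cauchySeq_of_norm_sub_le_mul K (fun m n => hnorm _ _ _ (hr m n) ((hdiff m n).2 i j)) hcau
  choose f hf using fun i => cauchySeq_tendsto_of_complete (hwc i)
  choose g hg using fun i j => cauchySeq_tendsto_of_complete (hgc i j)
  choose W hWp hWe using fun i => exists_periodic_extension C (f i)
  choose G hGp hGe using fun i j => exists_periodic_extension C (g i j)
  refine ⟨W, G, ⟨fun i => (hWp i).memL2Per ((Lp.memLp (f i)).ae_eq (hWe i).symm), fun i j =>
    ⟨(hGp i j).memL2Per ((Lp.memLp (g i j)).ae_eq (hGe i j).symm), fun φ hφ hc => ?_⟩⟩, ?_⟩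
  · have h1 := tendsto_integral_mul (fun n => hw n i) (hf i) (hWp i) (hWe i)
      (continuous_pderiv hφ j) (hasCompactSupport_pderiv hc j)
    have h2 := tendsto_integral_mul (fun n => (hw n i).partialDeriv j) (hg i j) (hGp i j)
      (hGe i j) hφ.continuous hc
    simp only [integral_mul_pderiv (hw _ i).smooth hφ hc j] at h1
    exact tendsto_nhds_unique h1 h2.neg
  · refine ae_all_iff.2 fun i => ae_all_iff.2 fun j => ?_
    have h1 : Tendsto (fun n => (compL i j).compLpL 2 C.meas (s n)) atTop
        (𝓝 ((compL i j).compLpL 2 C.meas e)) :=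
      (((compL i j).compLpL 2 C.meas).continuous.tendsto e).comp hlim
    have h2 := ((hg i j).add (hg j i)).const_smul (1 / 2 : ℝ)
    have h3 : ∀ n, (compL i j).compLpL 2 C.meas (s n) =
        (1 / 2 : ℝ) • (((hw n i).partialDeriv j).memLp_two.toLp (pderiv j (w n i)) +
          ((hw n j).partialDeriv i).memLp_two.toLp (pderiv i (w n j))) := by
      intro n
      rw [← MemLp.toLp_add, ← MemLp.toLp_const_smul]
      ext1
      filter_upwards [(compL i j).coeFn_compLpL (s n), MemLp.coeFn_toLp
        ((((hw n i).partialDeriv j).memLp_two.add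
          ((hw n j).partialDeriv i).memLp_two).const_smul (1 / 2 : ℝ)), hws n] with x h1 h2 h3
      rw [h1, h2, compL_apply, h3]
      rfl
    simp only [h3] at h1
    have h4 := tendsto_nhds_unique h1 h2
    filter_upwards [(compL i j).coeFn_compLpL e, Lp.coeFn_smul (1 / 2 : ℝ) (g i j + g j i),
      Lp.coeFn_add (g i j) (g j i), hGe i j, hGe j i] with x k1 k2 k3 k4 k5
    rw [← compL_apply, ← k1, h4, k2, Pi.smul_apply, k3, Pi.add_apply, k4, k5, smul_eq_mul]

theorem smoothStrains_subset {e : TField C} (he : e ∈ smoothStrains C) : e ∈ compatFields C :=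
  mem_compatFields_of_tendsto (s := fun _ => e) (fun _ => he) tendsto_const_nhds

/-- Admissible stresses and compatible strains are orthogonal complements of each other. -/
theorem mem_admStresses_iff {s : TField C} :
    s ∈ admStresses C ↔ ∀ e ∈ compatFields C, inner ℝ s e = 0 :=
  ⟨fun hs _ he => inner_admStresses_compatFields hs he, fun h =>
    mem_admStresses_of_orthogonal fun e he => h e (smoothStrains_subset he)⟩

/-- Every field orthogonal to the smooth strains lies in `S`. So a field orthogonal to `S` is in the
double complement of the smooth strains, hence a limit of them, hence compatible. -/
theorem mem_compatFields_iff {e : TField C} :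
    e ∈ compatFields C ↔ ∀ s ∈ admStresses C, inner ℝ s e = 0 := by
  refine ⟨fun he s hs => inner_admStresses_compatFields hs he, fun h => ?_⟩
  obtain ⟨u, hu, hlim⟩ := exists_seq_tendsto_of_orthogonal
    (K := (smoothStrains C : Set (TField C))) (smoothStrains C).zero_mem
    (fun a ha b hb => (smoothStrains C).add_mem ha hb)
    (fun c a ha => (smoothStrains C).smul_mem c ha)
    (fun s hs => h s (mem_admStresses_of_orthogonal hs))
  exact mem_compatFields_of_tendsto hu hlim

end Closure

end PeriodicElasticity

namespace PeriodicElasticity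

open MeasureTheory Filter Topology
open scoped ContDiff ENNReal

/-! ### The abstract two-field principle in a Hilbert space -/

section Energy

variable {H : Type*} [NormedAddCommGroup H] [InnerProductSpace ℝ H]

/-- A symmetric, uniformly positive definite operator. -/
structure IsPosOp (A : H →L[ℝ] H) : Prop where
  symm : ∀ x y, inner ℝ (A x) y = inner ℝ (A y) x
  coercive : ∃ c : ℝ, 0 < c ∧ ∀ x, c * ‖x‖ ^ 2 ≤ inner ℝ (A x) x

namespace IsPosOp

variable {A : H →L[ℝ] H}

theorem nonneg (hA : IsPosOp A) (x : H) : 0 ≤ inner ℝ (A x) x := by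
  obtain ⟨c, hc, h⟩ := hA.coercive
  exact le_trans (by positivity) (h x)

theorem eq_zero (hA : IsPosOp A) {x : H} (hx : inner ℝ (A x) x = 0) : x = 0 := by
  obtain ⟨c, hc, h⟩ := hA.coercive
  have h1 := h x
  rw [hx] at h1
  have h2 : ‖x‖ ^ 2 = 0 := le_antisymm (by nlinarith [sq_nonneg ‖x‖]) (sq_nonneg _)
  simpa using h2

theorem injective (hA : IsPosOp A) : Function.Injective A := by
  intro x y hxy
  have : A (x - y) = 0 := by rw [map_sub, hxy, sub_self]
  exact sub_eq_zero.1 (hA.eq_zero (by rw [this, inner_zero_left]))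

/-- Lax–Milgram on a complete subspace. -/
theorem exists_galerkin (hA : IsPosOp A) (E : Submodule ℝ H) [CompleteSpace E] (τ : H) :
    ∃ e ∈ E, ∀ k ∈ E, inner ℝ (A e - τ) k = 0 := by
  have hproj : ∀ (x : H) (k : E), inner ℝ (E.orthogonalProjectionOnto x) k = inner ℝ x (k : H) := by
    exact fun x k => Submodule.inner_orthogonalProjectionOnto_eq_of_mem_right k x
  let AE : E →L[ℝ] E := E.orthogonalProjectionOnto.comp (A.comp E.subtypeL)
  let b : E →L[ℝ] E →L[ℝ] ℝ := (innerSL ℝ).comp AE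
  have hb : ∀ x y : E, b x y = inner ℝ (A x) (y : H) := fun x y => hproj _ _
  have hcoe : IsCoercive b := by
    obtain ⟨c, hc, h⟩ := hA.coercive
    refine ⟨c, hc, fun x => ?_⟩
    rw [hb, mul_assoc, ← pow_two]
    exact h x
  let e : E := hcoe.continuousLinearEquivOfBilin.symm (E.orthogonalProjectionOnto τ)
  refine ⟨e, e.2, fun k hk => ?_⟩
  have h1 := hcoe.continuousLinearEquivOfBilin_apply e ⟨k, hk⟩
  rw [hb] at h1
  simp only [e, ContinuousLinearEquiv.apply_symm_apply] at h1
  rw [hproj] at h1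
  rw [inner_sub_left, ← h1, sub_self]

theorem galerkin_unique (hA : IsPosOp A) {E : Submodule ℝ H} {τ e e' : H} (he : e ∈ E)
    (ho : ∀ k ∈ E, inner ℝ (A e - τ) k = 0) (he' : e' ∈ E)
    (ho' : ∀ k ∈ E, inner ℝ (A e' - τ) k = 0) : e = e' := by
  have hk := E.sub_mem he he'
  refine sub_eq_zero.1 (hA.eq_zero ?_)
  have h1 := ho _ hk
  have h2 := ho' _ hk
  rw [map_sub, ← sub_sub_sub_cancel_right (A e) (A e') τ, inner_sub_left, h1, h2, sub_zero]

theorem surjective (hA : IsPosOp A) [CompleteSpace H] : Function.Surjective A := by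
  intro τ
  have : CompleteSpace (⊤ : Submodule ℝ H) :=
    (isClosed_univ : IsClosed ((⊤ : Submodule ℝ H) : Set H)).completeSpace_coe
  obtain ⟨e, -, he⟩ := hA.exists_galerkin ⊤ τ
  exact ⟨e, sub_eq_zero.1 (inner_self_eq_zero.1 (he _ trivial))⟩

end IsPosOp

/-- The data of the two-field principle: stiffness operators `A` and `B`, the closed subspace `E`
of compatible fields, the Green operator `G`, the inverse `Bi` of `B`, and a datum `u`. -/
structure EnergyData (A B : H →L[ℝ] H) (E : Submodule ℝ H) (G Bi : H → H) (u : H) : Prop where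
  posA : IsPosOp A
  posB : IsPosOp B
  complete : CompleteSpace E
  mem : ∀ τ, G τ ∈ E
  orth : ∀ τ, ∀ k ∈ E, inner ℝ (A (G τ) - τ) k = 0
  inv : ∀ τ, B (Bi τ) = τ
  datum : ∀ k ∈ E, inner ℝ (A u) k = 0

/-- The two-field energy. -/
noncomputable def energy (A B : H →L[ℝ] H) (G Bi : H → H) (u τ η : H) : ℝ :=
  (1 / 2) * inner ℝ (A (η - G (A η) - u)) (η - G (A η) - u) +
    (1 / 2) * inner ℝ (B (η - Bi τ)) (η - Bi τ) + (1 / 2) * inner ℝ (A (G τ)) (G τ)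

/-- The functional is quadratic along lines, so a vanishing directional derivative kills the linear
coefficient. -/
theorem eq_zero_of_tendsto_div {f : ℝ → ℝ} {a l q : ℝ} (hf : ∀ t, f t = a + t * l + t ^ 2 * q)
    (h : Tendsto (fun t : ℝ => (f t - a) / t) (𝓝[≠] 0) (𝓝 0)) : l = 0 := by
  have h1 : Tendsto (fun t : ℝ => l + t * q) (𝓝[≠] 0) (𝓝 l) := by
    have : Tendsto (fun t : ℝ => l + t * q) (𝓝 0) (𝓝 (l + 0 * q)) :=
      Continuous.tendsto (by fun_prop) 0
    simpa using this.mono_left nhdsWithin_le_nhds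
  refine tendsto_nhds_unique (h1.congr' ?_) h
  filter_upwards [self_mem_nhdsWithin] with t ht
  rw [hf]
  have : t ≠ 0 := ht
  field_simp
  ring

namespace EnergyData

variable {A B : H →L[ℝ] H} {E : Submodule ℝ H} {G Bi : H → H} {u : H}

/-- `G` is given as a bare function; its linearity and its values are all read off from this
uniqueness. -/
theorem green_eq (D : EnergyData A B E G Bi u) {τ e : H} (he : e ∈ E)
    (ho : ∀ k ∈ E, inner ℝ (A e - τ) k = 0) : G τ = e :=
  D.posA.galerkin_unique (D.mem τ) (D.orth τ) he ho

theorem green_add_smul (D : EnergyData A B E G Bi u) (τ τ' : H) (t : ℝ) :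
    G (τ + t • τ') = G τ + t • G τ' := by
  refine D.green_eq (E.add_mem (D.mem τ) (E.smul_mem t (D.mem τ'))) fun k hk => ?_
  have e1 : A (G τ + t • G τ') - (τ + t • τ') = (A (G τ) - τ) + t • (A (G τ') - τ') := by
    rw [map_add, map_smul, smul_sub]
    abel
  rw [e1, inner_add_left, real_inner_smul_left, D.orth τ k hk, D.orth τ' k hk]
  simp

theorem green_sub (D : EnergyData A B E G Bi u) (τ τ' : H) : G (τ - τ') = G τ - G τ' := by
  have := D.green_add_smul τ τ' (-1)
  simpa [sub_eq_add_neg] using this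

theorem inv_add_smul (D : EnergyData A B E G Bi u) (τ τ' : H) (t : ℝ) :
    Bi (τ + t • τ') = Bi τ + t • Bi τ' := by
  refine D.posB.injective ?_
  rw [D.inv, map_add, map_smul, D.inv, D.inv]

theorem inv_sub (D : EnergyData A B E G Bi u) (τ τ' : H) : Bi (τ - τ') = Bi τ - Bi τ' := by
  have := D.inv_add_smul τ τ' (-1)
  simpa [sub_eq_add_neg] using this

theorem inv_apply (D : EnergyData A B E G Bi u) (η : H) : Bi (B η) = η := D.posB.injective (D.inv _)

theorem green_apply_of_mem (D : EnergyData A B E G Bi u) {e : H} (he : e ∈ E) : G (A e) = e :=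
  D.green_eq he fun k _ => by rw [sub_self, inner_zero_left]

theorem green_eq_zero_iff (D : EnergyData A B E G Bi u) (τ : H) :
    G τ = 0 ↔ ∀ k ∈ E, inner ℝ τ k = 0 := by
  constructor
  · intro h k hk
    have := D.orth τ k hk
    rw [h, map_zero, zero_sub, inner_neg_left, neg_eq_zero] at this
    exact this
  · intro h
    exact D.green_eq E.zero_mem fun k hk => by
      rw [map_zero, zero_sub, inner_neg_left, h k hk, neg_zero]

/-- `G A` is a projector onto `E`, and it annihilates `u` because `A u` is orthogonal to `E`. -/
theorem sub_green_eq_iff (D : EnergyData A B E G Bi u) (η : H) : η - G (A η) = u ↔ η - u ∈ E := by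
  constructor
  · intro h
    rw [← h, sub_sub_cancel]
    exact D.mem _
  · intro h
    have h1 : G (A u) = 0 := (D.green_eq_zero_iff _).2 D.datum
    have h2 : G (A (η - u)) = η - u := D.green_apply_of_mem h
    rw [map_sub, D.green_sub, h1, sub_zero] at h2
    rw [h2, sub_sub_cancel]

theorem energy_nonneg (D : EnergyData A B E G Bi u) (τ η : H) : 0 ≤ energy A B G Bi u τ η := by
  unfold energy
  have h1 := D.posA.nonneg (η - G (A η) - u)
  have h2 := D.posB.nonneg (η - Bi τ)
  have h3 := D.posA.nonneg (G τ)
  positivity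

theorem energy_eq_zero_iff (D : EnergyData A B E G Bi u) (τ η : H) :
    energy A B G Bi u τ η = 0 ↔ τ = B η ∧ η - G (A η) = u ∧ G τ = 0 := by
  constructor
  · intro h
    unfold energy at h
    have h1 := D.posA.nonneg (η - G (A η) - u)
    have h2 := D.posB.nonneg (η - Bi τ)
    have h3 := D.posA.nonneg (G τ)
    have k1 := D.posA.eq_zero (x := η - G (A η) - u) (by linarith)
    have k2 := D.posB.eq_zero (x := η - Bi τ) (by linarith)
    have k3 := D.posA.eq_zero (x := G τ) (by linarith)
    exact ⟨by rw [sub_eq_zero.1 k2, D.inv], sub_eq_zero.1 k1, k3⟩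
  · rintro ⟨rfl, h2, h3⟩
    unfold energy
    rw [h2, h3, D.inv_apply]
    simp

/-- With `η = u + e` and `e ∈ E`, what remains is that `B (u + e)` be orthogonal to `E`: Lax–Milgram
for `B` with datum `-(B u)`. -/
theorem exists_solution (D : EnergyData A B E G Bi u) :
    ∃ τ η : H, τ = B η ∧ η - G (A η) = u ∧ G τ = 0 := by
  have := D.complete
  obtain ⟨e, he, ho⟩ := D.posB.exists_galerkin E (-(B u))
  refine ⟨B (u + e), u + e, rfl, ?_, ?_⟩
  · rw [D.sub_green_eq_iff, add_sub_cancel_left]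
    exact he
  · rw [D.green_eq_zero_iff]
    intro k hk
    rw [map_add, add_comm, ← sub_neg_eq_add]
    exact ho k hk

theorem solution_unique (D : EnergyData A B E G Bi u) {τ η τ' η' : H}
    (h : τ = B η ∧ η - G (A η) = u ∧ G τ = 0)
    (h' : τ' = B η' ∧ η' - G (A η') = u ∧ G τ' = 0) : τ = τ' ∧ η = η' := by
  obtain ⟨rfl, h2, h3⟩ := h
  obtain ⟨rfl, h2', h3'⟩ := h'
  rw [D.sub_green_eq_iff] at h2 h2'
  rw [D.green_eq_zero_iff] at h3 h3'
  have hk : η - η' ∈ E := by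
    rw [← sub_sub_sub_cancel_right η η' u]
    exact E.sub_mem h2 h2'
  have : η = η' := by
    refine sub_eq_zero.1 (D.posB.eq_zero ?_)
    rw [map_sub, inner_sub_left, h3 _ hk, h3' _ hk, sub_zero]
  exact ⟨by rw [this], this⟩

theorem energy_add_smul_strain (D : EnergyData A B E G Bi u) (τ η v : H) (t : ℝ) :
    energy A B G Bi u τ (η + t • v) = energy A B G Bi u τ η +
      t * (inner ℝ (A (η - G (A η) - u)) (v - G (A v)) + inner ℝ (B (η - Bi τ)) v) +
      t ^ 2 * ((1 / 2) * inner ℝ (A (v - G (A v))) (v - G (A v)) +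
        (1 / 2) * inner ℝ (B v) v) := by
  have e1 : η + t • v - G (A (η + t • v)) - u = (η - G (A η) - u) + t • (v - G (A v)) := by
    rw [map_add, map_smul, D.green_add_smul, smul_sub]
    abel
  have e2 : η + t • v - Bi τ = (η - Bi τ) + t • v := by abel
  unfold energy
  rw [e1, e2]
  generalize η - G (A η) - u = a
  generalize v - G (A v) = b
  generalize η - Bi τ = c
  simp only [map_add, map_smul, inner_add_left, inner_add_right, real_inner_smul_left,
    real_inner_smul_right]
  rw [D.posA.symm b a, D.posB.symm v c]
  ring

theorem energy_add_smul_stress (D : EnergyData A B E G Bi u) (τ η v : H) (t : ℝ) :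
    energy A B G Bi u (τ + t • v) η = energy A B G Bi u τ η +
      t * (inner ℝ (A (G τ)) (G v) - inner ℝ (B (η - Bi τ)) (Bi v)) +
      t ^ 2 * ((1 / 2) * inner ℝ (A (G v)) (G v) + (1 / 2) * inner ℝ (B (Bi v)) (Bi v)) := by
  have e2 : η - Bi (τ + t • v) = (η - Bi τ) - t • Bi v := by
    rw [D.inv_add_smul]
    abel
  unfold energy
  rw [D.green_add_smul, e2]
  generalize η - G (A η) - u = a
  generalize η - Bi τ = c
  generalize Bi v = b
  simp only [map_add, map_sub, map_smul, inner_add_left, inner_add_right, inner_sub_left,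
    inner_sub_right, real_inner_smul_left, real_inner_smul_right]
  rw [D.posA.symm (G v) (G τ), D.posB.symm b c]
  ring

/-- A critical point of the energy is a zero of the energy. -/
theorem energy_eq_zero_of_critical (D : EnergyData A B E G Bi u) {τ η : H}
    (hη : ∀ v, inner ℝ (A (η - G (A η) - u)) (v - G (A v)) + inner ℝ (B (η - Bi τ)) v = 0)
    (hτ : ∀ v, inner ℝ (A (G τ)) (G v) - inner ℝ (B (η - Bi τ)) (Bi v) = 0) :
    energy A B G Bi u τ η = 0 := by
  -- The directions are the differences to the solution, for which all three residuals vanish.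
  -- Adding the two criticality conditions then reproduces the residuals paired with themselves,
  -- that is, twice the energy.
  obtain ⟨τ', η', rfl, h2, h3⟩ := D.exists_solution
  have k1 := hη (η - η')
  have k2 := hτ (τ - B η')
  rw [map_sub A η η', D.green_sub] at k1
  rw [D.green_sub, h3, sub_zero, D.inv_sub, D.inv_apply] at k2
  have e1 : η - η' - (G (A η) - G (A η')) = η - G (A η) - u := by
    rw [← h2]
    abel
  rw [e1] at k1
  have e2 : inner ℝ (B (η - Bi τ)) (η - η') - inner ℝ (B (η - Bi τ)) (Bi τ - η') =
      inner ℝ (B (η - Bi τ)) (η - Bi τ) := by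
    rw [← inner_sub_right]
    congr 1
    abel
  unfold energy
  linarith

end EnergyData

end Energy

end PeriodicElasticity

namespace PeriodicElasticity

open MeasureTheory Filter Topology
open scoped ContDiff ENNReal

/-! ### Pointwise tensors and the multiplication operators they define -/

section Pointwise

variable {V : Type*} [NormedAddCommGroup V] [InnerProductSpace ℝ V]

/-- The constant is the minimum of the quadratic form on the compact unit sphere. If the sphere is
empty the space is trivial and any constant works. -/
theorem exists_coercive_const [FiniteDimensional ℝ V] (L : V →L[ℝ] V)
    (hL : ∀ a : V, a ≠ 0 → 0 < inner ℝ (L a) a) :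
    ∃ c : ℝ, 0 < c ∧ ∀ a : V, c * ‖a‖ ^ 2 ≤ inner ℝ (L a) a := by
  by_cases hne : (Metric.sphere (0 : V) 1).Nonempty
  · obtain ⟨x, hx, hmin⟩ := (isCompact_sphere (0 : V) 1).exists_isMinOn hne
      (f := fun a => inner ℝ (L a) a) (by fun_prop)
    have hx1 : ‖x‖ = 1 := by simpa using hx
    have hx0 : x ≠ 0 := fun h => by simp [h] at hx1
    refine ⟨inner ℝ (L x) x, hL x hx0, fun a => ?_⟩
    by_cases ha : a = 0
    · simp [ha]
    have hn : ‖a‖ ≠ 0 := norm_ne_zero_iff.2 ha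
    have h1 : inner ℝ (L x) x ≤ inner ℝ (L (‖a‖⁻¹ • a)) (‖a‖⁻¹ • a) :=
      hmin (by simp [norm_smul, hn])
    rw [map_smul, real_inner_smul_left, real_inner_smul_right] at h1
    have h2 := mul_le_mul_of_nonneg_right h1 (sq_nonneg ‖a‖)
    refine h2.trans_eq ?_
    field_simp
  · refine ⟨1, one_pos, fun a => ?_⟩
    by_cases ha : a = 0
    · simp [ha]
    exact absurd ⟨‖a‖⁻¹ • a, by simp [norm_smul, norm_ne_zero_iff.2 ha]⟩ hne

theorem isInvertible_of_pos [FiniteDimensional ℝ V] (L : V →L[ℝ] V)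
    (hL : ∀ a : V, a ≠ 0 → 0 < inner ℝ (L a) a) : L.IsInvertible := by
  have hinj : Function.Injective L.toLinearMap := by
    rw [← LinearMap.ker_eq_bot, LinearMap.ker_eq_bot']
    intro a ha
    by_contra hne
    have h1 := hL a hne
    have h2 : L a = 0 := ha
    rw [h2, inner_zero_left] at h1
    exact lt_irrefl _ h1
  refine ⟨(LinearEquiv.ofInjectiveEndo L.toLinearMap hinj).toContinuousLinearEquiv, ?_⟩
  ext a
  rfl

/-- The form is compared at `‖L a‖ • a + ‖a‖ • L a`, where it is bounded above, and at the
difference of the same vectors, where it is nonnegative. Subtraction leaves `4 * ‖a‖ * ‖L a‖ ^ 3`;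
the weights give both vectors equal norm, which makes the constant sharp. -/
theorem opNorm_le_of_symm (L : V →L[ℝ] V) {β : ℝ}
    (hs : ∀ a b : V, inner ℝ (L a) b = inner ℝ (L b) a)
    (h : ∀ a : V, 0 ≤ inner ℝ (L a) a ∧ inner ℝ (L a) a ≤ β * ‖a‖ ^ 2) : ‖L‖ ≤ |β| := by
  refine L.opNorm_le_bound (abs_nonneg _) fun a => ?_
  set x := ‖a‖ with hx
  set y := ‖L a‖ with hy
  have hx0 : 0 ≤ x := norm_nonneg _
  have hy0 : 0 ≤ y := norm_nonneg _
  have h1 := (h (y • a + x • L a)).2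
  have h2 := (h (y • a - x • L a)).1
  have h3 : ‖y • a + x • L a‖ ≤ 2 * (x * y) := by
    refine (norm_add_le _ _).trans_eq ?_
    rw [norm_smul, norm_smul, norm_norm, norm_norm]
    ring
  have h4 : ‖y • a + x • L a‖ ^ 2 ≤ (2 * (x * y)) ^ 2 := by gcongr
  have h5 : β * ‖y • a + x • L a‖ ^ 2 ≤ |β| * (2 * (x * y)) ^ 2 :=
    mul_le_mul (le_abs_self _) h4 (sq_nonneg _) (abs_nonneg _)
  have h6 : inner ℝ (L a) (L a) = y ^ 2 := real_inner_self_eq_norm_sq _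
  simp only [map_add, map_sub, map_smul, inner_add_left, inner_add_right, inner_sub_left,
    inner_sub_right, real_inner_smul_left, real_inner_smul_right] at h1 h2
  rw [hs (L a) a, h6] at h1 h2
  have h7 : x * y ^ 2 * y ≤ x * y ^ 2 * (|β| * x) := by nlinarith
  rcases hy0.eq_or_lt with hy1 | hy1
  · rw [← hy1]
    positivity
  rcases hx0.eq_or_lt with hx1 | hx1
  · have : a = 0 := norm_eq_zero.1 hx1.symm
    simp [hy, hx, this]
  exact le_of_mul_le_mul_left h7 (by positivity)

variable {X : Type*} [MeasurableSpace X] {μ : Measure X}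

theorem isPosOp_of_pointwise {T : Lp V 2 μ →L[ℝ] Lp V 2 μ} {L : X → V →L[ℝ] V} {α : ℝ}
    (hα : 0 < α) (hT : ∀ f : Lp V 2 μ, ∀ᵐ x ∂μ, T f x = L x (f x))
    (hL : ∀ᵐ x ∂μ, (∀ a b : V, inner ℝ (L x a) b = inner ℝ (L x b) a) ∧
      ∀ a : V, α * ‖a‖ ^ 2 ≤ inner ℝ (L x a) a) : IsPosOp T where
  symm f g := by
    rw [L2.inner_def, L2.inner_def]
    refine integral_congr_ae ?_
    filter_upwards [hT f, hT g, hL] with x h1 h2 h3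
    rw [h1, h2, h3.1]
  coercive := by
    refine ⟨α, hα, fun f => ?_⟩
    rw [← real_inner_self_eq_norm_sq, L2.inner_def, L2.inner_def, ← integral_const_mul]
    refine integral_mono_ae ((L2.integrable_inner f f).const_mul _) (L2.integrable_inner _ f) ?_
    filter_upwards [hT f, hL] with x h1 h2
    rw [h1, real_inner_self_eq_norm_sq]
    exact h2.2 _

/-- Multiplication by a bounded field of operators. -/
theorem exists_mulOp {L : X → V →L[ℝ] V} (hm : AEStronglyMeasurable L μ) {β : ℝ}
    (hβ : ∀ᵐ x ∂μ, ‖L x‖ ≤ β) : ∃ T : Lp V 2 μ →L[ℝ] Lp V 2 μ,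
      ∀ f : Lp V 2 μ, ∀ᵐ x ∂μ, T f x = L x (f x) := by
  have hmem : MemLp L ⊤ μ := memLp_top_of_bound hm β hβ
  refine ⟨(ContinuousLinearMap.id ℝ (V →L[ℝ] V)).holderL μ ⊤ 2 2 (hmem.toLp L), fun f => ?_⟩
  have h := (ContinuousLinearMap.id ℝ (V →L[ℝ] V)).coeFn_holder (r := 2) (hmem.toLp L) f
  filter_upwards [h, hmem.coeFn_toLp] with x h1 h2
  refine h1.trans ?_
  rw [h2]
  rfl

variable (μ) in
/-- Mean energetic product of strain fields. -/
noncomputable def meanStrainInner (L₀ : V →L[ℝ] V) (η η' : Lp V 2 μ) : ℝ :=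
  ⨍ x, inner ℝ (L₀ (η x)) (η' x) ∂μ

variable (μ) in
/-- Mean energetic product of stress fields. -/
noncomputable def meanStressInner (L₀ : V →L[ℝ] V) (τ τ' : Lp V 2 μ) : ℝ :=
  ⨍ x, inner ℝ (τ x) (L₀.inverse (τ' x)) ∂μ

theorem average_eq_mul (f : X → ℝ) : ⨍ x, f x ∂μ = (μ.real Set.univ)⁻¹ * ∫ x, f x ∂μ := by
  rw [average_eq, smul_eq_mul]

theorem meanStrainInner_eq (L₀ : V →L[ℝ] V) (η η' : Lp V 2 μ) :
    meanStrainInner μ L₀ η η' = (μ.real Set.univ)⁻¹ * inner ℝ (L₀.compLpL 2 μ η) η' := by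
  unfold meanStrainInner
  rw [average_eq_mul, L2.inner_def]
  congr 1
  refine integral_congr_ae ?_
  filter_upwards [L₀.coeFn_compLpL η] with x hx
  rw [hx]

theorem meanStressInner_eq (L₀ : V →L[ℝ] V) (τ τ' : Lp V 2 μ) :
    meanStressInner μ L₀ τ τ' = (μ.real Set.univ)⁻¹ * inner ℝ τ (L₀.inverse.compLpL 2 μ τ') := by
  unfold meanStressInner
  rw [average_eq_mul, L2.inner_def]
  congr 1
  refine integral_congr_ae ?_
  filter_upwards [L₀.inverse.coeFn_compLpL τ'] with x hx
  rw [hx]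

theorem compLpL_inverse_apply {L₀ : V →L[ℝ] V} (h : L₀.IsInvertible) (f : Lp V 2 μ) :
    L₀.inverse.compLpL 2 μ (L₀.compLpL 2 μ f) = f := by
  ext1
  filter_upwards [L₀.inverse.coeFn_compLpL (L₀.compLpL 2 μ f), L₀.coeFn_compLpL f] with x h1 h2
  rw [h1, h2, h.inverse_apply_self]

theorem compLpL_apply_inverse {L₀ : V →L[ℝ] V} (h : L₀.IsInvertible) (f : Lp V 2 μ) :
    L₀.compLpL 2 μ (L₀.inverse.compLpL 2 μ f) = f := by
  ext1
  filter_upwards [L₀.coeFn_compLpL (L₀.inverse.compLpL 2 μ f), L₀.inverse.coeFn_compLpL f]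
    with x h1 h2
  rw [h1, h2, h.self_apply_inverse]

end Pointwise

/-! ### The two-field principle for mutually orthogonal sets of fields -/

section TwoField

variable {V : Type*} [NormedAddCommGroup V] [InnerProductSpace ℝ V] [FiniteDimensional ℝ V]
  {X : Type*} [MeasurableSpace X] {μ : Measure X}

/-- The set of compatible fields as a closed subspace. -/
theorem exists_submodule {E S : Set (Lp V 2 μ)} (hE : ∀ e, e ∈ E ↔ ∀ s ∈ S, inner ℝ s e = 0) :
    ∃ M : Submodule ℝ (Lp V 2 μ), CompleteSpace M ∧ ∀ e, e ∈ M ↔ e ∈ E := by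
  refine ⟨(Submodule.span ℝ S)ᗮ, (Submodule.isClosed_orthogonal _).completeSpace_coe, fun e => ?_⟩
  rw [hE]
  refine ⟨fun h s hs => (Submodule.mem_orthogonal _ _).1 h s (Submodule.subset_span hs), fun h => ?_⟩
  rw [Submodule.mem_orthogonal]
  intro s hs
  induction hs using Submodule.span_induction with
  | mem s hs => exact h s hs
  | zero => exact inner_zero_left _
  | add a b _ _ ha hb => rw [inner_add_left, ha, hb, add_zero]
  | smul c a _ ha => rw [real_inner_smul_left, ha, mul_zero]

/-- The two-field variational principle, for fields of values in a Euclidean space and mutually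
orthogonal sets of compatible and equilibrated fields. -/
theorem two_field_principle [IsFiniteMeasure μ] [NeZero μ] {L₀ : V →L[ℝ] V}
    (hs₀ : ∀ a b : V, inner ℝ (L₀ a) b = inner ℝ (L₀ b) a)
    (hp₀ : ∀ a : V, a ≠ 0 → 0 < inner ℝ (L₀ a) a)
    {L : X → V →L[ℝ] V} (hm : AEStronglyMeasurable L μ) {α β : ℝ} (hα : 0 < α)
    (hL : ∀ᵐ x ∂μ, (∀ a b : V, inner ℝ (L x a) b = inner ℝ (L x b) a) ∧
      ∀ a : V, α * ‖a‖ ^ 2 ≤ inner ℝ (L x a) a ∧ inner ℝ (L x a) a ≤ β * ‖a‖ ^ 2)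
    {E S : Set (Lp V 2 μ)} (hE : ∀ e, e ∈ E ↔ ∀ s ∈ S, inner ℝ s e = 0)
    (hS : ∀ s, s ∈ S ↔ ∀ e ∈ E, inner ℝ s e = 0) (hconst : ∀ v, Lp.const 2 μ v ∈ S) (v : V)
    {pE pS g : Lp V 2 μ → Lp V 2 μ}
    (hpE : ∀ η, (∃ p, IsOrthProj (meanStrainInner μ L₀) E η p) →
      IsOrthProj (meanStrainInner μ L₀) E η (pE η))
    (hpS : ∀ τ, (∃ p, IsOrthProj (meanStressInner μ L₀) (orthCompl (meanStressInner μ L₀) S) τ p) →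
      IsOrthProj (meanStressInner μ L₀) (orthCompl (meanStressInner μ L₀) S) τ (pS τ))
    (hg : ∀ τ, (∃ e, e ∈ E ∧ L₀.compLp e - τ ∈ S) → g τ ∈ E ∧ L₀.compLp (g τ) - τ ∈ S)
    {F : Lp V 2 μ → Lp V 2 μ → ℝ}
    (hF : ∀ τ η, F τ η = (1 / 2) * meanStrainInner μ L₀ (η - pE η - Lp.const 2 μ v)
        (η - pE η - Lp.const 2 μ v) +
      (⨍ x, ((1 / 2) * inner ℝ (L x (η x)) (η x) + (1 / 2) * inner ℝ (τ x) ((L x).inverse (τ x)) -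
        inner ℝ (τ x) (η x)) ∂μ) + (1 / 2) * meanStressInner μ L₀ (pS τ) (pS τ)) :
    ((∀ η, ∃! p, IsOrthProj (meanStrainInner μ L₀) E η p) ∧
      (∀ τ, ∃! p, IsOrthProj (meanStressInner μ L₀) (orthCompl (meanStressInner μ L₀) S) τ p) ∧
      (∀ τ, ∃! e, e ∈ E ∧ L₀.compLp e - τ ∈ S)) ∧
    (∀ σ ε, IsGradAt (meanStressInner μ L₀) (fun τ => F τ ε) σ 0 →
      IsGradAt (meanStrainInner μ L₀) (fun η => F σ η) ε 0 →
      (∀ᵐ x ∂μ, σ x = L x (ε x)) ∧ ε - g (L₀.compLp ε) = Lp.const 2 μ v ∧ g σ = 0) ∧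
    (∀ σ ε, ((∀ᵐ x ∂μ, σ x = L x (ε x)) ∧ ε - g (L₀.compLp ε) = Lp.const 2 μ v ∧ g σ = 0) ↔
      ((∃ u ∈ Set.range (Lp.const 2 μ), ∃ e ∈ E, ε = u + e) ∧ ⨍ x, ε x ∂μ = v) ∧
        (∀ᵐ x ∂μ, σ x = L x (ε x)) ∧ σ ∈ S) ∧
    (∃! q : Lp V 2 μ × Lp V 2 μ, ∀ q' : Lp V 2 μ × Lp V 2 μ, F q.1 q.2 ≤ F q'.1 q'.2) ∧
    (∀ σ ε, (∀ τ η, F σ ε ≤ F τ η) ↔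
      ((∃ u ∈ Set.range (Lp.const 2 μ), ∃ e ∈ E, ε = u + e) ∧ ⨍ x, ε x ∂μ = v) ∧
        (∀ᵐ x ∂μ, σ x = L x (ε x)) ∧ σ ∈ S) := by
  have : CompleteSpace V := FiniteDimensional.complete ℝ V
  -- the operators
  obtain ⟨M, hMc, hM⟩ := exists_submodule hE
  obtain ⟨c₀, hc₀, hcoe₀⟩ := exists_coercive_const L₀ hp₀
  have hinv₀ := isInvertible_of_pos L₀ hp₀
  set A : Lp V 2 μ →L[ℝ] Lp V 2 μ := L₀.compLpL 2 μ with hA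
  have hAc : ∀ f : Lp V 2 μ, L₀.compLp f = A f := fun f => rfl
  have posA : IsPosOp A := isPosOp_of_pointwise (L := fun _ => L₀) hc₀
    (fun f => L₀.coeFn_compLpL f) (Eventually.of_forall fun _ => ⟨hs₀, hcoe₀⟩)
  obtain ⟨B, hB⟩ := exists_mulOp hm (β := |β|) (hL.mono fun x hx =>
    opNorm_le_of_symm (L x) hx.1 fun a => ⟨le_trans (by positivity) (hx.2 a).1, (hx.2 a).2⟩)
  have posB : IsPosOp B := isPosOp_of_pointwise hα hB
    (hL.mono fun x hx => ⟨hx.1, fun a => (hx.2 a).1⟩)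
  -- The inverse comes from Lax–Milgram rather than from the field of pointwise inverses, whose
  -- measurability is thus never needed.
  choose Bi hBi using posB.surjective
  choose G hGm hGo using posA.exists_galerkin M
  set m : ℝ := (μ.real Set.univ)⁻¹ with hmdef
  have hm0 : 0 < m := inv_pos.2 (measureReal_univ_pos)
  -- fields of zero mean, and mean values
  have hmean : ∀ e ∈ E, ∫ x, e x ∂μ = 0 := by
    intro e he
    refine integral_eq_zero_of_forall_integral_inner_eq_zero (𝕜 := ℝ) _
      ((Lp.memLp e).integrable (by simp)) fun a => ?_
    rw [← (hE e).1 he _ (hconst a), L2.inner_def]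
    refine integral_congr_ae ?_
    filter_upwards [Lp.coeFn_const (p := 2) (μ := μ) a] with x hx
    rw [hx]
    rfl
  have hAconst : ∀ a : V, A (Lp.const 2 μ a) = Lp.const 2 μ (L₀ a) := by
    intro a
    ext1
    filter_upwards [L₀.coeFn_compLpL (Lp.const 2 μ a), Lp.coeFn_const (p := 2) (μ := μ) a,
      Lp.coeFn_const (p := 2) (μ := μ) (L₀ a)] with x h1 h2 h3
    rw [h1, h2, h3]
    rfl
  have D : EnergyData A B M G Bi (Lp.const 2 μ v) :=
    { posA := posA
      posB := posB
      complete := hMc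
      mem := hGm
      orth := hGo
      inv := hBi
      datum := fun k hk => by
        rw [hAconst]
        exact (hE k).1 ((hM k).1 hk) _ (hconst _) }
  -- the Green operator and the projectors
  have hSM : ∀ s, s ∈ S ↔ ∀ k ∈ M, inner ℝ s k = 0 := fun s => by
    rw [hS]
    exact ⟨fun h k hk => h k ((hM k).1 hk), fun h k hk => h k ((hM k).2 hk)⟩
  have hgreen : ∀ τ e, (e ∈ E ∧ L₀.compLp e - τ ∈ S) ↔ e = G τ := by
    intro τ e
    rw [← hM, hAc, hSM]
    exact ⟨fun h => (D.green_eq h.1 h.2).symm, fun h => h ▸ ⟨hGm τ, hGo τ⟩⟩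
  -- Energetic orthogonality of `η - p` to `E` says that `A p - A η` is orthogonal to `E`: the
  -- Eshelby problem with datum `A η`.
  have hprojE : ∀ η p, IsOrthProj (meanStrainInner μ L₀) E η p ↔ p = G (A η) := by
    intro η p
    rw [← hgreen, hAc, hSM]
    refine and_congr_right fun _ => ?_
    simp only [meanStrainInner_eq, mul_eq_zero, hm0.ne', false_or, ← hmdef]
    refine ⟨fun h k hk => ?_, fun h k hk => ?_⟩
    · rw [← neg_sub, inner_neg_left, neg_eq_zero, ← map_sub]
      exact h k ((hM k).1 hk)
    · have := h k ((hM k).2 hk)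
      rw [← neg_sub, inner_neg_left, neg_eq_zero, ← map_sub] at this
      exact this
  set Ai : Lp V 2 μ →L[ℝ] Lp V 2 μ := L₀.inverse.compLpL 2 μ with hAi
  have hAiA : ∀ f, Ai (A f) = f := compLpL_inverse_apply hinv₀
  have hAAi : ∀ f, A (Ai f) = f := compLpL_apply_inverse hinv₀
  have hAis : ∀ f h, inner ℝ f (Ai h) = inner ℝ (Ai f) h := by
    intro f h
    have := posA.symm (Ai f) (Ai h)
    rw [hAAi, hAAi] at this
    rw [this, real_inner_comm]
  -- The complement of `S` for the stress product is the image of `E` under `A`, so projecting onto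
  -- it is again an Eshelby problem.
  have horth : ∀ p, p ∈ orthCompl (meanStressInner μ L₀) S ↔ Ai p ∈ E := by
    intro p
    rw [hE]
    refine forall₂_congr fun s _ => ?_
    rw [meanStressInner_eq, ← hAi, hAis, real_inner_comm, ← hmdef, mul_eq_zero]
    simp [hm0.ne']
  have hprojS : ∀ τ p, IsOrthProj (meanStressInner μ L₀) (orthCompl (meanStressInner μ L₀) S) τ p ↔
      p = A (G τ) := by
    intro τ p
    have h1 : p = A (G τ) ↔ Ai p = G τ :=
      ⟨fun h => by rw [h, hAiA], fun h => by rw [← h, hAAi]⟩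
    rw [h1, ← hgreen, hAc, hAAi, hSM]
    refine and_congr (horth p) ?_
    simp only [horth, meanStressInner_eq, mul_eq_zero, hm0.ne', false_or, ← hmdef, ← hAi]
    refine ⟨fun h k hk => ?_, fun h k hk => ?_⟩
    · have := h (A k) (by rw [hAiA]; exact (hM k).1 hk)
      rw [hAiA] at this
      rw [← neg_sub, inner_neg_left, this, neg_zero]
    · have := h (Ai k) ((hM _).2 hk)
      rw [← neg_sub, inner_neg_left, neg_eq_zero] at this
      exact this
  have hgG : ∀ τ, g τ = G τ := fun τ => (hgreen τ _).1 (hg τ ⟨G τ, (hgreen τ _).2 rfl⟩)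
  have hpEG : ∀ η, pE η = G (A η) := fun η =>
    (hprojE η _).1 (hpE η ⟨G (A η), (hprojE η _).2 rfl⟩)
  have hpSG : ∀ τ, pS τ = A (G τ) := fun τ =>
    (hprojS τ _).1 (hpS τ ⟨A (G τ), (hprojS τ _).2 rfl⟩)
  -- the functional
  have hecr : ∀ τ η : Lp V 2 μ, (⨍ x, ((1 / 2) * inner ℝ (L x (η x)) (η x) +
      (1 / 2) * inner ℝ (τ x) ((L x).inverse (τ x)) - inner ℝ (τ x) (η x)) ∂μ) =
      m * ((1 / 2) * inner ℝ (B (η - Bi τ)) (η - Bi τ)) := by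
    intro τ η
    rw [average_eq_mul, L2.inner_def, ← integral_const_mul (1 / 2 : ℝ)]
    congr 1
    refine integral_congr_ae ?_
    have h1 := hB (Bi τ)
    rw [hBi] at h1
    filter_upwards [hB (η - Bi τ), Lp.coeFn_sub η (Bi τ), h1, hL] with x k1 k2 k3 k4
    have hpos : ∀ a : V, a ≠ 0 → 0 < inner ℝ (L x a) a := fun a ha =>
      lt_of_lt_of_le (mul_pos hα (pow_pos (norm_pos_iff.2 ha) 2)) (k4.2 a).1
    have k5 := (isInvertible_of_pos (L x) hpos).inverse_apply_self (Bi τ x)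
    rw [k1, k2, Pi.sub_apply, k3, k5, map_sub]
    simp only [inner_sub_left, inner_sub_right]
    rw [k4.1 (η x) (Bi τ x)]
    ring
  have hFe : ∀ τ η, F τ η = m * energy A B G Bi (Lp.const 2 μ v) τ η := by
    intro τ η
    rw [hF, hecr, hpEG, hpSG, meanStrainInner_eq, meanStressInner_eq, ← hA, ← hAi, hAiA]
    unfold energy
    ring
  -- the equations
  have hconstit : ∀ σ ε : Lp V 2 μ, (∀ᵐ x ∂μ, σ x = L x (ε x)) ↔ σ = B ε := by
    intro σ ε
    constructor
    · intro h
      ext1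
      filter_upwards [h, hB ε] with x h1 h2
      rw [h1, h2]
    · rintro rfl
      exact hB ε
  have heqs : ∀ σ ε : Lp V 2 μ,
      ((∀ᵐ x ∂μ, σ x = L x (ε x)) ∧ ε - g (L₀.compLp ε) = Lp.const 2 μ v ∧ g σ = 0) ↔
      (σ = B ε ∧ ε - G (A ε) = Lp.const 2 μ v ∧ G σ = 0) := by
    intro σ ε
    rw [hconstit, hgG, hgG, hAc]
  -- Fields of `E` have zero mean, so the prescribed mean determines the uniform part.
  have hadm : ∀ ε : Lp V 2 μ, ((∃ u ∈ Set.range (Lp.const 2 μ), ∃ e ∈ E, ε = u + e) ∧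
      ⨍ x, ε x ∂μ = v) ↔ ε - Lp.const 2 μ v ∈ M := by
    intro ε
    have havg : ∀ (a : V), ∀ e ∈ E, ⨍ x, (Lp.const 2 μ a + e : Lp V 2 μ) x ∂μ = a := by
      intro a e he
      have h1 : ⇑(Lp.const 2 μ a + e : Lp V 2 μ) =ᵐ[μ] fun x => a + e x := by
        filter_upwards [Lp.coeFn_add (Lp.const 2 μ a) e, Lp.coeFn_const (p := 2) (μ := μ) a]
          with x h1 h2
        rw [h1, Pi.add_apply, h2]
        rfl
      rw [average_congr h1, average_eq, integral_add (integrable_const _)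
        ((Lp.memLp e).integrable (by simp)), hmean e he, integral_const, add_zero, smul_smul,
        inv_mul_cancel₀ (inv_pos.1 hm0).ne', one_smul]
    rw [hM]
    constructor
    · rintro ⟨⟨_, ⟨a, rfl⟩, e, he, rfl⟩, h2⟩
      rw [havg a e he] at h2
      rw [h2, add_sub_cancel_left]
      exact he
    · intro h
      have h1 : ε = Lp.const 2 μ v + (ε - Lp.const 2 μ v) := by abel
      refine ⟨⟨_, ⟨v, rfl⟩, _, h, h1⟩, ?_⟩
      rw [h1]
      exact havg v _ h
  have helas : ∀ σ ε : Lp V 2 μ, (((∃ u ∈ Set.range (Lp.const 2 μ), ∃ e ∈ E, ε = u + e) ∧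
      ⨍ x, ε x ∂μ = v) ∧ (∀ᵐ x ∂μ, σ x = L x (ε x)) ∧ σ ∈ S) ↔
      (σ = B ε ∧ ε - G (A ε) = Lp.const 2 μ v ∧ G σ = 0) := by
    intro σ ε
    rw [hadm, hconstit, hSM, D.sub_green_eq_iff, D.green_eq_zero_iff]
    tauto
  obtain ⟨τ₀, η₀, hsol⟩ := D.exists_solution
  -- The energy is nonnegative and vanishes at the solution, so the minimizers are exactly its
  -- zeros.
  have hmin : ∀ σ ε, (∀ τ η, F σ ε ≤ F τ η) ↔
      (σ = B ε ∧ ε - G (A ε) = Lp.const 2 μ v ∧ G σ = 0) := by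
    intro σ ε
    rw [← D.energy_eq_zero_iff]
    constructor
    · intro h
      have h1 := h τ₀ η₀
      rw [hFe, hFe, (D.energy_eq_zero_iff _ _).2 hsol] at h1
      exact le_antisymm (le_of_mul_le_mul_left h1 hm0) (D.energy_nonneg _ _)
    · intro h τ η
      rw [hFe, hFe, h, mul_zero]
      exact mul_nonneg hm0.le (D.energy_nonneg _ _)
  refine ⟨⟨fun η => ?_, fun τ => ?_, fun τ => ?_⟩, fun σ ε h1 h2 => ?_, fun σ ε => ?_, ?_,
    fun σ ε => ?_⟩
  · simp only [hprojE]
    exact ⟨_, rfl, fun _ h => h⟩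
  · simp only [hprojS]
    exact ⟨_, rfl, fun _ h => h⟩
  · simp only [hgreen]
    exact ⟨_, rfl, fun _ h => h⟩
  · rw [heqs, ← D.energy_eq_zero_iff]
    refine D.energy_eq_zero_of_critical (fun w => ?_) fun w => ?_
    · have h := h2 w
      rw [meanStrainInner_eq, map_zero, inner_zero_left, mul_zero] at h
      refine (mul_eq_zero.1 (eq_zero_of_tendsto_div (q :=
        m * ((1 / 2) * inner ℝ (A (w - G (A w))) (w - G (A w)) + (1 / 2) * inner ℝ (B w) w))
        (fun t => ?_) h)).resolve_left hm0.ne'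
      beta_reduce
      rw [hFe, hFe, D.energy_add_smul_strain]
      ring
    · have h := h1 w
      rw [meanStressInner_eq, inner_zero_left, mul_zero] at h
      refine (mul_eq_zero.1 (eq_zero_of_tendsto_div (q :=
        m * ((1 / 2) * inner ℝ (A (G w)) (G w) + (1 / 2) * inner ℝ (B (Bi w)) (Bi w)))
        (fun t => ?_) h)).resolve_left hm0.ne'
      beta_reduce
      rw [hFe, hFe, D.energy_add_smul_stress]
      ring
  · rw [heqs, helas]
  · refine ⟨(τ₀, η₀), fun q' => (hmin _ _).2 hsol _ _, fun q hq => ?_⟩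
    have h := (hmin q.1 q.2).1 fun τ η => hq (τ, η)
    obtain ⟨k1, k2⟩ := D.solution_unique h hsol
    exact Prod.ext k1 k2
  · rw [helas, hmin]

end TwoField

/-! ### Specialisation to the periodic cell -/

theorem orthProj_spec {H : Type*} [AddCommGroup H] {ip : H → H → ℝ} {K : Set H} {η : H}
    (h : ∃ p, IsOrthProj ip K η p) : IsOrthProj ip K η (orthProj ip K η) := by
  unfold orthProj
  rw [dif_pos h]
  exact h.choose_spec

variable {d : ℕ} {C : UnitCell d}

theorem green_spec {L₀ : Tensor4 d} {τ : TField C} (h : ∃ e, IsEshelbySolution C L₀ τ e) :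
    IsEshelbySolution C L₀ τ (green C L₀ τ) := by
  unfold green
  rw [dif_pos h]
  exact h.choose_spec

theorem zero_mem_selfEqFields : (0 : TField C) ∈ selfEqFields C := by
  have hz : ⇑(0 : TField C) =ᵐ[C.meas] fun _ => 0 := Lp.coeFn_zero (SymTensor d) 2 C.meas
  refine ⟨⟨fun _ _ _ => 0, fun _ _ => ?_, ?_, fun _ _ _ _ => by simp⟩, ?_⟩
  · exact (smoothPer_const C 0).per.memL2Per (smoothPer_const C 0).memLp_two
  · filter_upwards [hz] with x hx i j
    rw [hx, ← compL_apply, map_zero]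
  · rw [average_congr hz]
    simp

theorem const_mem_admStresses (a : SymTensor d) : Lp.const 2 C.meas a ∈ admStresses C :=
  ⟨_, ⟨a, rfl⟩, 0, zero_mem_selfEqFields, (add_zero _).symm⟩

end PeriodicElasticity

theorem mainTheorem6 (d : ℕ) (C : UnitCell d) (L₀ : Tensor4 d) (hL₀ : L₀.IsStiffness)
    (L : Space d → Tensor4 d) (hL : IsElasticity C L) (εbar : SymTensor d) :
    -- the projectors and the Green's operator are well defined
    ((∀ η : TField C, ∃! p, IsOrthProj (strainInner C L₀) (compatFields C) η p) ∧
      (∀ τ : TField C, ∃! p, IsOrthProj (stressInner C L₀) (admStressesOrth C L₀) τ p) ∧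
      (∀ τ : TField C, ∃! e, IsEshelbySolution C L₀ τ e)) ∧
    -- vanishing partial gradients imply the three equations
    (∀ σ ε : TField C, IsStressGrad C L₀ L εbar σ ε 0 → IsStrainGrad C L₀ L εbar σ ε 0 →
      SatisfiesOptimalityEqs C L₀ L εbar σ ε) ∧
    -- the three equations are the elasticity problem
    (∀ σ ε : TField C, SatisfiesOptimalityEqs C L₀ L εbar σ ε ↔
      IsElasticSolution C L εbar σ ε) ∧
    -- there is exactly one minimizer, and it is the solution of the elasticity problem
    (∃! q : TField C × TField C, ∀ q' : TField C × TField C,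
      costP C L₀ L εbar q.1 q.2 ≤ costP C L₀ L εbar q'.1 q'.2) ∧
    (∀ σ ε : TField C, (∀ τ η : TField C, costP C L₀ L εbar σ ε ≤ costP C L₀ L εbar τ η) ↔
      IsElasticSolution C L εbar σ ε) := by
  obtain ⟨hm, α, β, hα, hbound⟩ := hL
  have hne : NeZero C.meas := ⟨fun h => C.volume_cell_ne_zero (by simpa using h)⟩
  have hconst : ∀ a : SymTensor d, MeasureTheory.Lp.const 2 C.meas a ∈ admStresses C :=
    const_mem_admStresses
  exact two_field_principle (μ := C.meas) (L₀ := L₀) hL₀.1 hL₀.2 hm hα hbound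
    (E := compatFields C) (S := admStresses C)
    (fun e => mem_compatFields_iff) (fun s => mem_admStresses_iff) hconst εbar
    (pE := projCompat C L₀) (pS := projStressOrth C L₀) (g := green C L₀)
    (fun η h => orthProj_spec h) (fun τ h => orthProj_spec h) (fun τ h => green_spec h)
    (F := costP C L₀ L εbar) (fun τ η => rfl)
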